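/- Let $0\le m\le n$ be integers, let $A\in M_n(\mathbb R)$ be a constant symmetric positive definite matrix, and let $X=\mathbb C^m\times\mathbb R^{n-m}\times\mathbb T^{n-m}$, $\mathbb T=\mathbb R/2\pi\mathbb Z$, with its standard toric structure: the moment map $\mu=(x_1,\dots,x_n)\colon X\to\mathbb R_{\ge 0}^m\times\mathbb R^{n-m}$ is given by $x_j=|\zeta_j|^2/2$ on the factors $\mathbb C\ni\zeta_j=\sqrt{2x_j}\,e^{i\theta_j}$ ($1\le j\le m$) and by the coordinates of $\mathbb R^{n-m}$ for $j>m$, and $\theta_{m+1},\dots,\theta_n$ are the coordinates of $\mathbb T^{n-m}$. For $s>0$ put $$G_s=s^{-1}(Y_m+A),\qquad Y_m=\mathrm{diag}\Bigl(\frac{s}{2x_1},\dots,\frac{s}{2x_m},0,\dots,0\Bigr),$$ and let $g_s$ be the smooth Riemannian metric on $X$ that equals ${}^t\!dx\,G_s\,dx+{}^t\!d\theta\,G_s^{-1}\,d\theta$ on the open dense set where $x_1,\dots,x_m>0$. Let $$H=\bigcup_{1\le i\ne j\le m}\mu^{-1}\bigl(\{x\in\mathbb R_{\ge0}^m\times\mathbb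 R^{n-m}: x_i=x_j=0\}\bigr)$$ be the preimage of the union of the codimension-two faces, and let $B_{g_s}(H,\tilde r)=\{p\in X: d_{g_s}(H,p)<\tilde r\}$, where $d_{g_s}$ is the Riemannian distance (the neighbourhood is empty if $H=\emptyset$). Then for every $\tilde r>0$ there exists $\kappa\in\mathbb R$ such that for all $0<s<1$ $$\mathrm{Ric}(g_s)\ge\kappa\, g_s\quad\text{on } X\setminus B_{g_s}(H,\tilde r).$$ -/

import Mathlib

open scoped ContDiff ENNReal

noncomputable section

namespace ToricModel

/-! ### Riemannian geometry in a coordinate space -/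

section Coordinates

variable {E : Type*} [NormedAddCommGroup E] [NormedSpace ℝ E]

/-- The covector `w ↦ ½ (∂ᵤ g(v, w) + ∂ᵥ g(u, w) - ∂_w g(u, v))` at `p`, for constant vector
fields `u`, `v` on a coordinate space `E` with metric tensor `g`. -/
def koszul (g : E → E →L[ℝ] E →L[ℝ] ℝ) (p u v : E) : E →L[ℝ] ℝ :=
  (1 / 2 : ℝ) • (fderiv ℝ g p u v + fderiv ℝ g p v u - ((fderiv ℝ g p).flip u).flip v)

/-- The Christoffel symbol `Γ_p(u, v)` of the Levi-Civita connection: the vector that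
represents `koszul g p u v` with respect to the inner product `g p`. -/
def christoffel (g : E → E →L[ℝ] E →L[ℝ] ℝ) (p u v : E) : E :=
  (g p).inverse (koszul g p u v)

/-- The Riemann curvature tensor
`R(u, v) w = ∂ᵤ Γ(v, w) - ∂ᵥ Γ(u, w) + Γ(u, Γ(v, w)) - Γ(v, Γ(u, w))`. -/
def riemann (g : E → E →L[ℝ] E →L[ℝ] ℝ) (p u v w : E) : E :=
  fderiv ℝ (fun q => christoffel g q v w) p u - fderiv ℝ (fun q => christoffel g q u w) p v
    + christoffel g p u (christoffel g p v w) - christoffel g p v (christoffel g p u w)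

/-- The Ricci tensor `Ric(v, w) = trace (u ↦ R(u, v) w)`; the trace is written out in a basis. -/
def ricci [FiniteDimensional ℝ E] (g : E → E →L[ℝ] E →L[ℝ] ℝ) (p v w : E) : ℝ :=
  ∑ i, (Module.finBasis ℝ E).coord i (riemann g p (Module.finBasis ℝ E i) v w)

/-- The length of a curve `γ : [0, 1] → E` with respect to the metric tensor `g`. -/
def curveLength (g : E → E →L[ℝ] E →L[ℝ] ℝ) (γ : ℝ → E) : ℝ≥0∞ :=
  ∫⁻ t in Set.Icc (0 : ℝ) 1, ENNReal.ofReal (√(g (γ t) (deriv γ t) (deriv γ t)))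

/-- The bilinear form `∑ i j, M i j • φ i ⊗ φ j`. -/
def tensorForm {ι : Type*} [Fintype ι] (M : Matrix ι ι ℝ) (φ : ι → E →L[ℝ] ℝ) :
    E →L[ℝ] E →L[ℝ] ℝ :=
  ∑ i, ∑ j, M i j • (φ i).smulRight (φ j)

end Coordinates

/-! ### The model space

Here `n = m + k`; indices `Sum.inl j` are the first `m` ones, `Sum.inr l` the last `n - m`. -/

/-- `ℂᵐ × ℝᵏ × 𝕋ᵏ` with `𝕋 = ℝ / 2πℤ`. -/
abbrev Space (m k : ℕ) : Type := (Fin m → ℂ) × (Fin k → ℝ) × (Fin k → Real.Angle)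

/-- The universal cover `ℂᵐ × ℝᵏ × ℝᵏ`. It serves as coordinate space: the covering map `proj`
is a local diffeomorphism, and it identifies every tangent space of `Space m k` with
`Cover m k`. -/
abbrev Cover (m k : ℕ) : Type := (Fin m → ℂ) × (Fin k → ℝ) × (Fin k → ℝ)

variable {m k : ℕ}

/-- The covering map. -/
def proj (q : Cover m k) : Space m k := (q.1, q.2.1, fun l => (q.2.2 l : Real.Angle))

/-- The moment map `(ζ, x, θ) ↦ (|ζ₁|²/2, …, |ζₘ|²/2, x)`; thus `ζⱼ = √(2 xⱼ) exp(i θⱼ)`. -/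
def moment (p : Space m k) : Fin m ⊕ Fin k → ℝ :=
  Sum.elim (fun j => ‖p.1 j‖ ^ 2 / 2) p.2.1

/-- The preimage under the moment map of the union of the codimension two faces of
`ℝ_{≥0}ᵐ × ℝᵏ`. -/
def codimTwo (m k : ℕ) : Set (Space m k) :=
  {p | ∃ i j : Fin m, i ≠ j ∧ moment p (Sum.inl i) = 0 ∧ moment p (Sum.inl j) = 0}

/-- The real one-form `Re dζⱼ`. -/
def dRe (j : Fin m) : Cover m k →L[ℝ] ℝ :=
  Complex.reCLM.comp ((ContinuousLinearMap.proj j).comp (ContinuousLinearMap.fst ℝ _ _))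

/-- The real one-form `Im dζⱼ`. -/
def dIm (j : Fin m) : Cover m k →L[ℝ] ℝ :=
  Complex.imCLM.comp ((ContinuousLinearMap.proj j).comp (ContinuousLinearMap.fst ℝ _ _))

/-- The one-forms `dx` at the point `p`, where `x` is the moment map. -/
def dx (p : Space m k) : Fin m ⊕ Fin k → Cover m k →L[ℝ] ℝ :=
  Sum.elim (fun j => (p.1 j).re • dRe j + (p.1 j).im • dIm j)
    (fun l => (ContinuousLinearMap.proj l).comp
      ((ContinuousLinearMap.fst ℝ _ _).comp (ContinuousLinearMap.snd ℝ _ _)))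

/-- The one-forms `dθₗ` of the torus factor. -/
def dTorus (l : Fin k) : Cover m k →L[ℝ] ℝ :=
  (ContinuousLinearMap.proj l).comp
    ((ContinuousLinearMap.snd ℝ _ _).comp (ContinuousLinearMap.snd ℝ _ _))

/-- The one-form `2 xⱼ dθⱼ = Im (conj ζⱼ dζⱼ)` of the factor `ℂ`, smooth at `ζⱼ = 0`. -/
def angular (p : Space m k) (j : Fin m) : Cover m k →L[ℝ] ℝ :=
  (p.1 j).re • dIm j - (p.1 j).im • dRe j

/-- The angular one-forms `dθ₁, …, dθₙ` at a point with `x₁, …, xₘ ≠ 0`. -/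
def dθ (p : Space m k) : Fin m ⊕ Fin k → Cover m k →L[ℝ] ℝ :=
  Sum.elim (fun j => (2 * moment p (Sum.inl j))⁻¹ • angular p j) dTorus

/-- `G_s = s⁻¹ (Y_m + A)` with `Y_m = diag (s / (2 x₁), …, s / (2 xₘ), 0, …, 0)`. -/
def hessG (A : Matrix (Fin m ⊕ Fin k) (Fin m ⊕ Fin k) ℝ) (s : ℝ) (p : Space m k) :
    Matrix (Fin m ⊕ Fin k) (Fin m ⊕ Fin k) ℝ :=
  s⁻¹ • (Matrix.diagonal (Sum.elim (fun j => s / (2 * moment p (Sum.inl j))) 0) + A)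

/-- The metric `ᵗdx G_s dx + ᵗdθ G_s⁻¹ dθ` at a point with `x₁, …, xₘ ≠ 0`. -/
def openMetric (A : Matrix (Fin m ⊕ Fin k) (Fin m ⊕ Fin k) ℝ) (s : ℝ) (p : Space m k) :
    Cover m k →L[ℝ] Cover m k →L[ℝ] ℝ :=
  tensorForm (hessG A s p) (dx p) + tensorForm (hessG A s p)⁻¹ (dθ p)

/-- The metric `g_s` on the whole model space: the smooth extension of `openMetric`
(see `metric_eq_openMetric` and `contDiff_metric`) in closed form. With `P = s A⁻¹` and
`Q = (diag (2 x₁, …, 2 xₘ) + P₁₁)⁻¹`, it is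
`∑ |dζⱼ|² + s⁻¹ ᵗdx A dx + ᵗdθ₂ P₂₂ dθ₂ - ᵗη Q η`, where `θ₂` is the coordinate on the torus
and `ηⱼ = 2 xⱼ dθⱼ - (P₁₂ dθ₂)ⱼ` for `1 ≤ j ≤ m`. -/
def metric (A : Matrix (Fin m ⊕ Fin k) (Fin m ⊕ Fin k) ℝ) (s : ℝ) (p : Space m k) :
    Cover m k →L[ℝ] Cover m k →L[ℝ] ℝ :=
  tensorForm 1 (fun j : Fin m => dRe j) + tensorForm 1 (fun j : Fin m => dIm j)
    + tensorForm (s⁻¹ • A) (dx p)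
    + tensorForm (s • A⁻¹).toBlocks₂₂ dTorus
    - tensorForm
        (Matrix.diagonal (fun j => 2 * moment p (Sum.inl j)) + (s • A⁻¹).toBlocks₁₁)⁻¹
        (fun j => angular p j - ∑ l, (s • A⁻¹).toBlocks₁₂ j l • dTorus l)

/-- The metric in the coordinates of the universal cover. -/
def coverMetric (A : Matrix (Fin m ⊕ Fin k) (Fin m ⊕ Fin k) ℝ) (s : ℝ) (q : Cover m k) :
    Cover m k →L[ℝ] Cover m k →L[ℝ] ℝ :=
  metric A s (proj q)

/-- The Riemannian distance of `g_s`: the infimum of the lengths of the `C¹` curves from `p` to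
`p'`. As `proj` is a covering, the `C¹` curves in the model space are the projections of the
`C¹` curves `γ` in the cover, and `γ` has the same length as its projection. -/
def riemDist (A : Matrix (Fin m ⊕ Fin k) (Fin m ⊕ Fin k) ℝ) (s : ℝ) (p p' : Space m k) : ℝ≥0∞ :=
  ⨅ (γ : ℝ → Cover m k) (_ : ContDiffOn ℝ 1 γ (Set.Icc 0 1))
    (_ : proj (γ 0) = p) (_ : proj (γ 1) = p'), curveLength (coverMetric A s) γ

/-- The `r`-neighbourhood of a subset `H` of the model space with respect to `g_s`. -/
def nbhd (A : Matrix (Fin m ⊕ Fin k) (Fin m ⊕ Fin k) ℝ) (s : ℝ) (H : Set (Space m k)) (r : ℝ) :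
    Set (Space m k) :=
  {p | (⨅ h ∈ H, riemDist A s h p) < ENNReal.ofReal r}

/-! ### The closed form is the smooth extension -/

theorem tensorForm_apply {E ι : Type*} [NormedAddCommGroup E] [NormedSpace ℝ E] [Fintype ι]
    (M : Matrix ι ι ℝ) (φ : ι → E →L[ℝ] ℝ) (v w : E) :
    tensorForm M φ v w = dotProduct (fun i => φ i v) (M.mulVec (fun i => φ i w)) := by
  simp only [tensorForm, dotProduct, Matrix.mulVec, _root_.sum_apply,
    _root_.smul_apply, ContinuousLinearMap.smulRight_apply, smul_eq_mul,
    Finset.mul_sum]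
  refine Finset.sum_congr rfl fun i _ => Finset.sum_congr rfl fun j _ => ?_
  ring

theorem posDef_inner {A : Matrix (Fin m ⊕ Fin k) (Fin m ⊕ Fin k) ℝ} (hA : A.PosDef) {s : ℝ}
    (hs : 0 < s) {d : Fin m → ℝ} (hd : ∀ j, 0 ≤ d j) :
    (Matrix.diagonal d + (s • A⁻¹).toBlocks₁₁).PosDef := by
  have h1 : (s • A⁻¹).PosDef := hA.inv.smul hs
  have h2 : ((s • A⁻¹).toBlocks₁₁).PosDef :=
    h1.submatrix (Sum.inl_injective)
  exact Matrix.PosDef.posSemidef_add (Matrix.PosSemidef.diagonal hd) h2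

theorem two_moment_pos (p : Space m k) {j : Fin m} (hp : p.1 j ≠ 0) :
    0 < 2 * moment p (Sum.inl j) := by
  have := norm_pos_iff.2 hp
  simp only [moment, Sum.elim_inl]
  positivity

/-- The inverse of `G_s` in terms of the blocks of `P = s A⁻¹`. -/
theorem hessG_inv {A : Matrix (Fin m ⊕ Fin k) (Fin m ⊕ Fin k) ℝ} (hA : A.PosDef) {s : ℝ}
    (hs : 0 < s) (p : Space m k) (hp : ∀ j, p.1 j ≠ 0) :
    (hessG A s p)⁻¹ = s • A⁻¹ -
      s • A⁻¹ * (Matrix.fromRows 1 0 : Matrix (Fin m ⊕ Fin k) (Fin m) ℝ) *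
      (Matrix.diagonal (fun j => 2 * moment p (Sum.inl j)) + (s • A⁻¹).toBlocks₁₁)⁻¹ *
      (Matrix.fromCols 1 0 : Matrix (Fin m) (Fin m ⊕ Fin k) ℝ) * (s • A⁻¹) := by
  have hd := fun j => two_moment_pos p (hp j)
  have hAu : IsUnit A := hA.isUnit
  have hsA : (s⁻¹ • A)⁻¹ = s • A⁻¹ := by
    refine Matrix.inv_eq_right_inv ?_
    rw [Matrix.smul_mul, Matrix.mul_smul, smul_smul, inv_mul_cancel₀ hs.ne', one_smul,
      Matrix.mul_nonsing_inv _ ((Matrix.isUnit_iff_isUnit_det _).1 hAu)]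
  have hdiag : (Matrix.diagonal fun j => (2 * moment p (Sum.inl j))⁻¹)⁻¹ =
      Matrix.diagonal (fun j => 2 * moment p (Sum.inl j)) := by
    refine Matrix.inv_eq_right_inv ?_
    rw [Matrix.diagonal_mul_diagonal, ← Matrix.diagonal_one]
    congr 1
    funext j
    exact inv_mul_cancel₀ (hd j).ne'
  have hG : hessG A s p = s⁻¹ • A + (Matrix.fromRows 1 0 : Matrix (Fin m ⊕ Fin k) (Fin m) ℝ) *
      Matrix.diagonal (fun j => (2 * moment p (Sum.inl j))⁻¹) *
      (Matrix.fromCols 1 0 : Matrix (Fin m) (Fin m ⊕ Fin k) ℝ) := by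
    rw [hessG, smul_add, add_comm]
    congr 1
    rw [Matrix.fromRows_mul, Matrix.fromRows_mul_fromCols]
    ext (i | i) (j | j)
    · rcases eq_or_ne i j with rfl | h
      · simp
        field_simp
      · simp [h]
    · simp
    · simp
    · simp [Matrix.diagonal_apply]
  have hB : (Matrix.fromCols 1 0 : Matrix (Fin m) (Fin m ⊕ Fin k) ℝ) * (s • A⁻¹) *
      (Matrix.fromRows 1 0 : Matrix (Fin m ⊕ Fin k) (Fin m) ℝ) = (s • A⁻¹).toBlocks₁₁ := by
    ext i j
    simp [Matrix.mul_apply, Fintype.sum_sum_type, Matrix.one_apply, Matrix.toBlocks₁₁]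
  rw [hG, Matrix.add_mul_mul_inv_eq_sub, hsA, hdiag, hB]
  · exact (hA.smul (inv_pos.2 hs)).isUnit
  · rw [Matrix.isUnit_iff_isUnit_det, Matrix.det_diagonal, isUnit_iff_ne_zero]
    exact Finset.prod_ne_zero_iff.2 fun j _ => inv_ne_zero (hd j).ne'
  · rw [hsA, hdiag, hB]
    exact (posDef_inner hA hs fun j => (hd j).le).isUnit

theorem quadratic_identity (P : Matrix (Fin m ⊕ Fin k) (Fin m ⊕ Fin k) ℝ) (hP : P.transpose = P)
    (d : Fin m → ℝ) (hR : IsUnit (Matrix.diagonal d + P.toBlocks₁₁).det)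
    (a a' : Fin m → ℝ) (b b' : Fin k → ℝ) :
    dotProduct (Sum.elim a b) (Matrix.mulVec (P -
      P * (Matrix.fromRows 1 0 : Matrix (Fin m ⊕ Fin k) (Fin m) ℝ) *
      (Matrix.diagonal d + P.toBlocks₁₁)⁻¹ *
      (Matrix.fromCols 1 0 : Matrix (Fin m) (Fin m ⊕ Fin k) ℝ) * P) (Sum.elim a' b')) =
    dotProduct a (Matrix.mulVec (Matrix.diagonal d) a') +
      dotProduct b (Matrix.mulVec P.toBlocks₂₂ b') -
      dotProduct (Matrix.mulVec (Matrix.diagonal d) a - Matrix.mulVec P.toBlocks₁₂ b)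
        (Matrix.mulVec (Matrix.diagonal d + P.toBlocks₁₁)⁻¹
          (Matrix.mulVec (Matrix.diagonal d) a' - Matrix.mulVec P.toBlocks₁₂ b')) := by
  have hPt : ∀ x y, P x y = P y x := fun x y => congrFun (congrFun hP.symm x) y
  obtain ⟨P11, h11⟩ : ∃ M, M = P.toBlocks₁₁ := ⟨_, rfl⟩
  obtain ⟨P12, h12⟩ : ∃ M, M = P.toBlocks₁₂ := ⟨_, rfl⟩
  obtain ⟨P22, h22⟩ : ∃ M, M = P.toBlocks₂₂ := ⟨_, rfl⟩
  have h21 : P.toBlocks₂₁ = P12.transpose := by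
    ext i j
    simp [h12, Matrix.toBlocks₂₁, Matrix.toBlocks₁₂, hPt (Sum.inr i)]
  have h11t : P11.transpose = P11 := by
    ext i j
    simp [h11, Matrix.toBlocks₁₁, hPt (Sum.inl i)]
  have hPb : P = Matrix.fromBlocks P11 P12 P12.transpose P22 := by
    rw [← h21, h11, h12, h22, Matrix.fromBlocks_toBlocks]
  rw [← h11, ← h12, ← h22]
  rw [← h11] at hR
  obtain ⟨R, hRdef⟩ : ∃ R, R = Matrix.diagonal d + P11 := ⟨_, rfl⟩
  have hRt : R.transpose = R := by
    rw [hRdef, Matrix.transpose_add, Matrix.diagonal_transpose, h11t]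
  have hDa : ∀ x, Matrix.mulVec (Matrix.diagonal d) x =
      Matrix.mulVec R x - Matrix.mulVec P11 x := by
    intro x
    rw [hRdef, Matrix.add_mulVec, add_sub_cancel_right]
  rw [← hRdef] at hR ⊢
  have hVP : ∀ (x : Fin m → ℝ) (y : Fin k → ℝ),
      Matrix.mulVec (Matrix.fromCols 1 0 : Matrix (Fin m) (Fin m ⊕ Fin k) ℝ)
        (Matrix.mulVec P (Sum.elim x y)) = Matrix.mulVec P11 x + Matrix.mulVec P12 y := by
    intro x y
    rw [hPb, Matrix.fromBlocks_mulVec, Matrix.fromCols_mulVec]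
    simp
  have hPU : ∀ (x : Fin m → ℝ), Matrix.mulVec P (Matrix.mulVec
      (Matrix.fromRows 1 0 : Matrix (Fin m ⊕ Fin k) (Fin m) ℝ) x) =
      Sum.elim (Matrix.mulVec P11 x) (Matrix.mulVec P12.transpose x) := by
    intro x
    rw [hPb, Matrix.fromRows_mulVec, Matrix.fromBlocks_mulVec]
    simp
  have hsym : ∀ {α β : Type} [Fintype α] [Fintype β] (M : Matrix α β ℝ) (x : α → ℝ) (y : β → ℝ),
      dotProduct x (Matrix.mulVec M y) = dotProduct (Matrix.mulVec M.transpose x) y := by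
    intro α β _ _ M x y
    rw [Matrix.dotProduct_mulVec, Matrix.mulVec_transpose]
  have hRi : ∀ x, Matrix.mulVec R⁻¹ (Matrix.mulVec R x) = x := by
    intro x
    rw [Matrix.mulVec_mulVec, Matrix.nonsing_inv_mul _ hR, Matrix.one_mulVec]
  have hRi' : ∀ x y, dotProduct (Matrix.mulVec R x) (Matrix.mulVec R⁻¹ y) = dotProduct x y := by
    intro x y
    rw [hsym, Matrix.transpose_nonsing_inv, hRt, hRi]
  rw [Matrix.sub_mulVec, dotProduct_sub]
  simp only [← Matrix.mulVec_mulVec]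
  rw [hVP, hPU]
  obtain ⟨ξ, hξ⟩ : ∃ ξ, ξ = Matrix.mulVec P11 a + Matrix.mulVec P12 b := ⟨_, rfl⟩
  obtain ⟨ξ', hξ'⟩ : ∃ ξ', ξ' = Matrix.mulVec P11 a' + Matrix.mulVec P12 b' := ⟨_, rfl⟩
  have e1 : ∀ x : Fin m → ℝ, dotProduct (Sum.elim a b)
      (Sum.elim (Matrix.mulVec P11 x) (Matrix.mulVec P12.transpose x)) = dotProduct ξ x := by
    intro x
    rw [sumElim_dotProduct_sumElim, hsym, hsym, h11t, Matrix.transpose_transpose, hξ,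
      add_dotProduct]
  have e2 : Matrix.mulVec (Matrix.diagonal d) a - Matrix.mulVec P12 b = Matrix.mulVec R a - ξ := by
    rw [hDa, hξ]; abel
  have e3 : Matrix.mulVec (Matrix.diagonal d) a' - Matrix.mulVec P12 b' =
      Matrix.mulVec R a' - ξ' := by
    rw [hDa, hξ']; abel
  rw [e1, e2, e3, ← hξ', Matrix.mulVec_sub, hRi, sub_dotProduct, dotProduct_sub, dotProduct_sub,
    hRi', hDa, hPb, Matrix.fromBlocks_mulVec, sumElim_dotProduct_sumElim]
  simp only [Sum.elim_comp_inl, Sum.elim_comp_inr, dotProduct_add, dotProduct_sub]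
  have e4 : dotProduct (Matrix.mulVec R a) a' = dotProduct a (Matrix.mulVec R a') := by
    rw [hsym, hRt]
  have e5 : dotProduct ξ a' = dotProduct a (Matrix.mulVec P11 a') +
      dotProduct b (Matrix.mulVec P12.transpose a') := by
    rw [hsym, hsym, h11t, Matrix.transpose_transpose, hξ, add_dotProduct]
  have e6 : dotProduct a ξ' = dotProduct a (Matrix.mulVec P11 a') +
      dotProduct a (Matrix.mulVec P12 b') := by
    rw [hξ', dotProduct_add]
  rw [e4, e5, e6]
  ring

/-- On the open dense set `x₁, …, xₘ ≠ 0` the metric is `ᵗdx G_s dx + ᵗdθ G_s⁻¹ dθ`. -/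
theorem metric_eq_openMetric {A : Matrix (Fin m ⊕ Fin k) (Fin m ⊕ Fin k) ℝ} (hA : A.PosDef)
    {s : ℝ} (hs : 0 < s) (p : Space m k) (hp : ∀ j, p.1 j ≠ 0) :
    metric A s p = openMetric A s p := by
  have hd := fun j => two_moment_pos p (hp j)
  have hAt : A.transpose = A := by
    have := hA.isHermitian
    rwa [Matrix.IsHermitian, Matrix.conjTranspose_eq_transpose_of_trivial] at this
  have hP : (s • A⁻¹).transpose = s • A⁻¹ := by
    rw [Matrix.transpose_smul, Matrix.transpose_nonsing_inv, hAt]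
  refine ContinuousLinearMap.ext fun v => ContinuousLinearMap.ext fun w => ?_
  have hθ : ∀ u, (fun i => dθ p i u) = Sum.elim
      (fun j => (2 * moment p (Sum.inl j))⁻¹ * angular p j u) (fun l => dTorus l u) := by
    intro u
    ext (j | l) <;> simp [dθ]
  have key := quadratic_identity (s • A⁻¹) hP (fun j => 2 * moment p (Sum.inl j))
    ((Matrix.isUnit_iff_isUnit_det _).1 (posDef_inner hA hs fun j => (hd j).le).isUnit)
    (fun j => (2 * moment p (Sum.inl j))⁻¹ * angular p j v)
    (fun j => (2 * moment p (Sum.inl j))⁻¹ * angular p j w)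
    (fun l => dTorus l v) (fun l => dTorus l w)
  have hη : ∀ u, (fun j => angular p j u -
      (∑ l, (s • A⁻¹).toBlocks₁₂ j l • dTorus l : Cover m k →L[ℝ] ℝ) u) = Matrix.mulVec (Matrix.diagonal (fun j => 2 * moment p (Sum.inl j)))
        (fun j => (2 * moment p (Sum.inl j))⁻¹ * angular p j u) -
        Matrix.mulVec (s • A⁻¹).toBlocks₁₂ (fun l => dTorus l u) := by
    intro u
    ext j
    have := (hd j).ne'
    rw [Pi.sub_apply, Matrix.mulVec_diagonal, mul_inv_cancel_left₀ this]
    simp only [_root_.sum_apply, _root_.smul_apply, Matrix.mulVec, dotProduct, smul_eq_mul]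
  simp only [metric, openMetric, _root_.add_apply, _root_.sub_apply, tensorForm_apply, hθ]
  rw [hessG_inv hA hs p hp, key, ← hη v, ← hη w, hessG, smul_add, Matrix.add_mulVec,
    dotProduct_add]
  have hflat : dotProduct (fun j => dRe j v) (Matrix.mulVec (1 : Matrix (Fin m) (Fin m) ℝ)
        (fun j => dRe j w)) + dotProduct (fun j => dIm j v)
        (Matrix.mulVec (1 : Matrix (Fin m) (Fin m) ℝ) (fun j => dIm j w)) =
      dotProduct (fun i => dx p i v) (Matrix.mulVec (s⁻¹ • Matrix.diagonal
        (Sum.elim (fun j => s / (2 * moment p (Sum.inl j))) 0)) (fun i => dx p i w)) +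
      dotProduct (fun j => (2 * moment p (Sum.inl j))⁻¹ * angular p j v)
        (Matrix.mulVec (Matrix.diagonal (fun j => 2 * moment p (Sum.inl j)))
          (fun j => (2 * moment p (Sum.inl j))⁻¹ * angular p j w)) := by
    simp only [Matrix.one_mulVec, Matrix.smul_mulVec, Matrix.mulVec_diagonal, dotProduct,
      Fintype.sum_sum_type, Pi.smul_apply, Sum.elim_inl, Sum.elim_inr, Pi.zero_apply, zero_mul,
      mul_zero, Finset.sum_const_zero, add_zero, ← Finset.sum_add_distrib, smul_eq_mul]
    refine Finset.sum_congr rfl fun j _ => ?_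
    have h1 := hd j
    have h2 : 2 * moment p (Sum.inl j) = (p.1 j).re ^ 2 + (p.1 j).im ^ 2 := by
      simp only [moment, Sum.elim_inl, ← Complex.normSq_eq_norm_sq, Complex.normSq_apply]
      ring
    rw [h2] at h1 ⊢
    simp only [dx, Sum.elim_inl, angular, _root_.add_apply, _root_.sub_apply, _root_.smul_apply,
      smul_eq_mul]
    field_simp
    ring
  linarith [hflat]

theorem contDiff_tensorForm {E ι : Type*} [NormedAddCommGroup E]
    [NormedSpace ℝ E] [Fintype ι] {M : E → Matrix ι ι ℝ}
    {φ : E → ι → E →L[ℝ] ℝ} (hM : ∀ i j, ContDiff ℝ ∞ fun q => M q i j)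
    (hφ : ∀ i, ContDiff ℝ ∞ fun q => φ q i) :
    ContDiff ℝ ∞ fun q => tensorForm (M q) (φ q) := by
  refine ContDiff.sum fun i _ => ContDiff.sum fun j _ => ?_
  have h : (fun q => M q i j • (φ q i).smulRight (φ q j)) =
      fun q => (M q i j • φ q i).smulRight (φ q j) := by
    funext q
    ext v w
    simp [mul_assoc]
  rw [h]
  exact ((hM i j).smul (hφ i)).smulRight (hφ j)

theorem contDiff_det {E ι : Type*} [NormedAddCommGroup E]
    [NormedSpace ℝ E] [Fintype ι] [DecidableEq ι] {M : E → Matrix ι ι ℝ}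
    (hM : ∀ i j, ContDiff ℝ ∞ fun q => M q i j) : ContDiff ℝ ∞ fun q => (M q).det := by
  simp only [Matrix.det_apply']
  exact ContDiff.sum fun σ _ => contDiff_const.mul (contDiff_prod fun i _ => hM _ _)

theorem contDiff_inv {E ι : Type*} [NormedAddCommGroup E]
    [NormedSpace ℝ E] [Fintype ι] [DecidableEq ι] {M : E → Matrix ι ι ℝ}
    (hM : ∀ i j, ContDiff ℝ ∞ fun q => M q i j) (hdet : ∀ q, (M q).det ≠ 0) (i j : ι) :
    ContDiff ℝ ∞ fun q => (M q)⁻¹ i j := by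
  simp only [Matrix.inv_def, Ring.inverse_eq_inv', Matrix.smul_apply, Matrix.adjugate_apply,
    smul_eq_mul]
  refine ((contDiff_det hM).inv hdet).mul (contDiff_det fun a b => ?_)
  by_cases h : a = j
  · subst h
    simp only [Matrix.updateRow_self]
    exact contDiff_const
  · simp only [Matrix.updateRow_ne h]
    exact hM a b

/-- The metric is smooth. -/
theorem contDiff_metric {A : Matrix (Fin m ⊕ Fin k) (Fin m ⊕ Fin k) ℝ} (hA : A.PosDef) {s : ℝ}
    (hs : 0 < s) : ContDiff ℝ ∞ (coverMetric A s) := by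
  have hre : ∀ j : Fin m, ContDiff ℝ ∞ fun q : Cover m k => (q.1 j).re :=
    fun j => (dRe j).contDiff
  have him : ∀ j : Fin m, ContDiff ℝ ∞ fun q : Cover m k => (q.1 j).im :=
    fun j => (dIm j).contDiff
  have hang : ∀ j : Fin m, ContDiff ℝ ∞ fun q : Cover m k => angular (proj q) j := fun j =>
    ((hre j).smul contDiff_const).sub ((him j).smul contDiff_const)
  have hmom : ∀ j : Fin m, ContDiff ℝ ∞
      fun q : Cover m k => 2 * moment (proj q) (Sum.inl j) := by
    intro j
    have : (fun q : Cover m k => 2 * moment (proj q) (Sum.inl j)) =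
        fun q => (q.1 j).re ^ 2 + (q.1 j).im ^ 2 := by
      funext q
      simp only [moment, proj, Sum.elim_inl, ← Complex.normSq_eq_norm_sq, Complex.normSq_apply]
      ring
    rw [this]
    exact ((hre j).pow 2).add ((him j).pow 2)
  have hnn : ∀ (q : Cover m k) (j : Fin m), 0 ≤ 2 * moment (proj q) (Sum.inl j) := by
    intro q j
    simp only [moment, Sum.elim_inl]
    positivity
  unfold coverMetric metric
  refine (((contDiff_const.add contDiff_const).add ?_).add contDiff_const).sub ?_
  · refine contDiff_tensorForm (fun i j => contDiff_const) ?_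
    rintro (j | l)
    · exact ((hre j).smul contDiff_const).add ((him j).smul contDiff_const)
    · exact contDiff_const
  · refine contDiff_tensorForm (contDiff_inv (fun i j => ?_) fun q => ?_) fun i => ?_
    · refine ContDiff.add ?_ contDiff_const
      simp only [Matrix.diagonal_apply]
      split_ifs
      · exact hmom i
      · exact contDiff_const
    · exact (posDef_inner hA hs (hnn q)).det_pos.ne'
    · exact (hang i).sub contDiff_const

end ToricModel

end

/-!
The Ricci curvature of a toric Kähler metric is explicit in action-angle coordinates `(x, θ)`. For
`ᵗdx G dx + ᵗdθ F dθ` with `F = G⁻¹` and `G = diag (φᵢ(xᵢ)) + B`, all derivatives of `G` are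
diagonal, and the coordinate volume is the Riemannian one, so that `Γ(·, w)` is trace free. With
`φᵢ' = -aᵢ` and `aᵢ' = bᵢ` this leaves, for a vector `(c, t)`,
`Ric = Q(c) + Q(F t)`, where
`-2 Q(c) = ∑ aₖ aₗ Fₖₖ Fₖₗ cₗ² + ∑ Fₖₖ bₖ cₖ² + ∑ Fₖₗ² aₖ aₗ cₖ cₗ`
(`IsHessianOn.ricci_metric`), while the metric is `ᵗc G c + ᵗ(F t) G (F t)`. The formula is carried
over to the coordinate space `Cover m k` by the invariance of the Ricci tensor under local
isometries (`IsLocalIsometryOn.ricci_source`).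

For `G_s` put `Y = diag (s / (2 xⱼ))` and `N = (Y + A)⁻¹`. For each `k`, the terms of `Q` with
`l = k` add up to a nonnegative multiple of `1 - Yₖ Nₖₖ ≥ 0`. Since `N` and `Y N` are bounded
uniformly in `Y ≥ 0`, a term with `k ≠ l` is bounded by a multiple of the metric as soon as `Yₖ²` or
`Yₗ²` is `O(s)`
(`exists_le_ricciForm`), that is, as soon as `xₖ` or `xₗ` is at least of order `√s`. This holds at
distance at least `r` from the codimension two faces: if `xₖ, xₗ ≤ ε √s`, the radial curve to
`ζₖ = ζₗ = 0` has squared length `O(ε)`, uniformly in `s < 1` (`exists_sqrt_lt_moment`).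

Action-angle coordinates exist where all `ζⱼ ≠ 0`. The remaining points are limits of such points,
the condition on the `xⱼ` is open, and both sides of the inequality are continuous because the
metric is smooth and nondegenerate everywhere (`metric_pos`, `continuous_ricci`).
-/

noncomputable section

namespace ToricModel

-- needed to find the norm on trilinear maps such as the derivative of a metric
set_option maxSynthPendingDepth 3
set_option linter.unusedSectionVars false

/-! ### The Levi-Civita connection as a bilinear map -/

section General

variable {E : Type*} [NormedAddCommGroup E] [NormedSpace ℝ E]

/-- The covector `koszul g p u v`, bundled as a bilinear map of `u` and `v`. -/
def koszulL (g : E → E →L[ℝ] E →L[ℝ] ℝ) (p : E) : E →L[ℝ] E →L[ℝ] E →L[ℝ] ℝ :=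
  (1 / 2 : ℝ) • (fderiv ℝ g p + (fderiv ℝ g p).flip -
    ((ContinuousLinearMap.flipₗᵢ ℝ E E ℝ : (E →L[ℝ] E →L[ℝ] ℝ) →L[ℝ] E →L[ℝ] E →L[ℝ] ℝ)).comp
      (fderiv ℝ g p).flip)

theorem koszulL_apply (g : E → E →L[ℝ] E →L[ℝ] ℝ) (p u v : E) :
    koszulL g p u v = koszul g p u v := by
  ext w
  simp [koszulL, koszul]

theorem koszul_apply (g : E → E →L[ℝ] E →L[ℝ] ℝ) (p u v w : E) :
    koszul g p u v w =
      (1 / 2 : ℝ) * (fderiv ℝ g p u v w + fderiv ℝ g p v u w - fderiv ℝ g p w u v) := by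
  simp [koszul]

/-- The Christoffel symbol at `p`, bundled as a bilinear map. -/
def christoffelL (g : E → E →L[ℝ] E →L[ℝ] ℝ) (p : E) : E →L[ℝ] E →L[ℝ] E :=
  (ContinuousLinearMap.compL ℝ E (E →L[ℝ] ℝ) E (g p).inverse).comp (koszulL g p)

theorem christoffelL_apply (g : E → E →L[ℝ] E →L[ℝ] ℝ) (p u v : E) :
    christoffelL g p u v = christoffel g p u v := by
  simp [christoffelL, christoffel, koszulL_apply]

theorem apply_christoffel {g : E → E →L[ℝ] E →L[ℝ] ℝ} {p : E} (hg : (g p).IsInvertible)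
    (u v w : E) : g p (christoffel g p u v) w = koszul g p u v w := by
  rw [christoffel, hg.self_apply_inverse]

theorem christoffel_eq_of_apply {g : E → E →L[ℝ] E →L[ℝ] ℝ} {p : E} (hg : (g p).IsInvertible)
    {u v x : E} (h : ∀ w, g p x w = koszul g p u v w) : christoffel g p u v = x := by
  rw [christoffel, hg.inverse_apply_eq]
  ext w
  exact (h w).symm

theorem contDiffAt_koszulL {g : E → E →L[ℝ] E →L[ℝ] ℝ} {p : E} (hg : ContDiffAt ℝ ∞ g p) :
    ContDiffAt ℝ ∞ (koszulL g) p := by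
  have h1 : ContDiffAt ℝ ∞ (fderiv ℝ g) p := hg.fderiv_right (by simp)
  have h2 : ContDiffAt ℝ ∞ (fun q => (fderiv ℝ g q).flip) p :=
    ((ContinuousLinearMap.flipₗᵢ ℝ E E (E →L[ℝ] ℝ)).contDiff.contDiffAt).comp p h1
  exact ((h1.add h2).sub (contDiffAt_const.clm_comp h2)).const_smul (1 / 2 : ℝ)

theorem contDiffAt_christoffelL [CompleteSpace E] {g : E → E →L[ℝ] E →L[ℝ] ℝ} {p : E}
    (hg : ContDiffAt ℝ ∞ g p) (hi : (g p).IsInvertible) :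
    ContDiffAt ℝ ∞ (christoffelL g) p := by
  have h1 : ContDiffAt ℝ ∞ (fun q => (g q).inverse) p :=
    (hi.contDiffAt_map_inverse).comp p hg
  have h2 : ContDiffAt ℝ ∞
      (fun q => ContinuousLinearMap.compL ℝ E (E →L[ℝ] ℝ) E (g q).inverse) p :=
    (ContinuousLinearMap.contDiff _).contDiffAt.comp p h1
  exact h2.clm_comp (contDiffAt_koszulL hg)

/-- The linear map `u ↦ R(u, v) w`, whose trace is the Ricci tensor. -/
def riemannL (g : E → E →L[ℝ] E →L[ℝ] ℝ) (p v w : E) : E →L[ℝ] E :=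
  ((fderiv ℝ (christoffelL g) p).flip v).flip w - (fderiv ℝ (christoffelL g) p v).flip w
    + (christoffelL g p).flip (christoffelL g p v w)
    - (christoffelL g p v).comp ((christoffelL g p).flip w)

theorem fderiv_christoffel {g : E → E →L[ℝ] E →L[ℝ] ℝ} {p : E}
    (hd : DifferentiableAt ℝ (christoffelL g) p) (u v w : E) :
    fderiv ℝ (fun q => christoffel g q v w) p u = fderiv ℝ (christoffelL g) p u v w := by
  have h := (hd.hasFDerivAt.clm_apply (hasFDerivAt_const v p)).clm_apply (hasFDerivAt_const w p)
  simp only [christoffelL_apply] at h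
  rw [h.fderiv]
  simp

theorem riemannL_apply {g : E → E →L[ℝ] E →L[ℝ] ℝ} {p : E}
    (hd : DifferentiableAt ℝ (christoffelL g) p) (u v w : E) :
    riemannL g p v w u = riemann g p u v w := by
  rw [riemann, fderiv_christoffel hd, fderiv_christoffel hd]
  simp [riemannL, christoffelL_apply]

variable [FiniteDimensional ℝ E]

/-- A pointwise positive definite form is invertible as a map to the dual space. -/
theorem isInvertible_of_pos {B : E →L[ℝ] E →L[ℝ] ℝ} (hB : ∀ v, v ≠ 0 → 0 < B v v) :
    B.IsInvertible := by
  let f : E →ₗ[ℝ] Module.Dual ℝ E :=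
    (LinearMap.toContinuousLinearMap (𝕜 := ℝ) (E := E) (F' := ℝ)).symm.toLinearMap ∘ₗ B.toLinearMap
  have hf : Function.Injective f := by
    rw [injective_iff_map_eq_zero]
    intro v hv
    by_contra h
    have h1 := hB v h
    have h2 : f v v = B v v := rfl
    rw [← h2, hv] at h1
    simp at h1
  let e := (LinearEquiv.ofInjectiveOfFinrankEq f hf Subspace.dual_finrank_eq.symm).trans
    (LinearMap.toContinuousLinearMap (𝕜 := ℝ) (E := E) (F' := ℝ))
  refine ⟨e.toContinuousLinearEquiv, ?_⟩
  ext v w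
  rfl

theorem ricci_eq_trace {g : E → E →L[ℝ] E →L[ℝ] ℝ} {p : E}
    (hd : DifferentiableAt ℝ (christoffelL g) p) (v w : E) :
    ricci g p v w = LinearMap.trace ℝ E (riemannL g p v w) := by
  rw [LinearMap.trace_eq_matrix_trace ℝ (Module.finBasis ℝ E)]
  simp [ricci, Matrix.trace, LinearMap.toMatrix_apply, riemannL_apply hd]

theorem ricci_eq_sum {ι : Type*} [Fintype ι] (b : Module.Basis ι ℝ E)
    {g : E → E →L[ℝ] E →L[ℝ] ℝ} {p : E}
    (hd : DifferentiableAt ℝ (christoffelL g) p) (v w : E) :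
    ricci g p v w = ∑ i, b.coord i (riemann g p (b i) v w) := by
  classical
  rw [ricci_eq_trace hd, LinearMap.trace_eq_matrix_trace ℝ b]
  simp [Matrix.trace, LinearMap.toMatrix_apply, riemannL_apply hd]

theorem continuous_ricci {g : E → E →L[ℝ] E →L[ℝ] ℝ} (hg : ContDiff ℝ ∞ g)
    (hi : ∀ p, (g p).IsInvertible) (v w : E) : Continuous fun p => ricci g p v w := by
  have hL : ContDiff ℝ ∞ (christoffelL g) :=
    contDiff_iff_contDiffAt.2 fun p => contDiffAt_christoffelL hg.contDiffAt (hi p)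
  have hc : Continuous (christoffelL g) := hL.continuous
  have hc' : Continuous (fderiv ℝ (christoffelL g)) := hL.continuous_fderiv (by simp)
  have hd : ∀ p, DifferentiableAt ℝ (christoffelL g) p :=
    fun p => (hL.differentiable (by simp)) p
  have h : ∀ p, ricci g p v w = ∑ i, (Module.finBasis ℝ E).coord i
      (fderiv ℝ (christoffelL g) p (Module.finBasis ℝ E i) v w
        - fderiv ℝ (christoffelL g) p v (Module.finBasis ℝ E i) w
        + christoffelL g p (Module.finBasis ℝ E i) (christoffelL g p v w)
        - christoffelL g p v (christoffelL g p (Module.finBasis ℝ E i) w)) := by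
    intro p
    simp only [ricci, riemann, fderiv_christoffel (hd p), christoffelL_apply]
  simp only [h]
  refine continuous_finsetSum _ fun i _ => ?_
  refine (LinearMap.continuous_of_finiteDimensional _).comp ?_
  fun_prop

end General

/-! ### Invariance of the Ricci tensor under local isometries -/

section Naturality

variable {E F : Type*} [NormedAddCommGroup E] [NormedSpace ℝ E] [NormedAddCommGroup F]
  [NormedSpace ℝ F]

theorem fderiv_apply_apply {g : E → E →L[ℝ] E →L[ℝ] ℝ} {q : E} (hg : DifferentiableAt ℝ g q)
    (u v w : E) : fderiv ℝ g q u v w = fderiv ℝ (fun q => g q v w) q u := by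
  have h := (hg.hasFDerivAt.clm_apply (hasFDerivAt_const v q)).clm_apply (hasFDerivAt_const w q)
  rw [h.fderiv]
  simp

theorem minSmoothness_two_le : minSmoothness ℝ 2 ≤ (∞ : WithTop ℕ∞) := by
  rw [minSmoothness_of_isRCLikeNormedField]
  exact WithTop.coe_le_coe.2 (le_top : (2 : ℕ∞) ≤ ⊤)

/-- `g` is the pullback of `h` under the smooth local diffeomorphism `ψ` of the open set `U`. -/
structure IsLocalIsometryOn (g : E → E →L[ℝ] E →L[ℝ] ℝ) (h : F → F →L[ℝ] F →L[ℝ] ℝ) (ψ : E → F)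
    (U : Set E) : Prop where
  isOpen : IsOpen U
  smooth : ∀ q ∈ U, ContDiffAt ℝ ∞ ψ q
  immersive : ∀ q ∈ U, (fderiv ℝ ψ q).IsInvertible
  smooth_source : ∀ q ∈ U, ContDiffAt ℝ ∞ g q
  smooth_target : ∀ q ∈ U, ContDiffAt ℝ ∞ h (ψ q)
  nondegenerate_source : ∀ q ∈ U, (g q).IsInvertible
  nondegenerate_target : ∀ q ∈ U, (h (ψ q)).IsInvertible
  symm : ∀ q ∈ U, ∀ u v, h (ψ q) u v = h (ψ q) v u
  pullback : ∀ q ∈ U, ∀ u v, g q u v = h (ψ q) (fderiv ℝ ψ q u) (fderiv ℝ ψ q v)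

namespace IsLocalIsometryOn

variable {g : E → E →L[ℝ] E →L[ℝ] ℝ} {h : F → F →L[ℝ] F →L[ℝ] ℝ} {ψ : E → F} {U : Set E}

theorem fderiv_source (H : IsLocalIsometryOn g h ψ U) {q : E} (hq : q ∈ U) (u v w : E) :
    fderiv ℝ g q u v w =
      fderiv ℝ h (ψ q) (fderiv ℝ ψ q u) (fderiv ℝ ψ q v) (fderiv ℝ ψ q w) +
      h (ψ q) (fderiv ℝ (fderiv ℝ ψ) q u v) (fderiv ℝ ψ q w) +
      h (ψ q) (fderiv ℝ ψ q v) (fderiv ℝ (fderiv ℝ ψ) q u w) := by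
  rw [fderiv_apply_apply ((H.smooth_source q hq).differentiableAt (by simp))]
  have hψ : HasFDerivAt ψ (fderiv ℝ ψ q) q :=
    ((H.smooth q hq).differentiableAt (by simp)).hasFDerivAt
  have hψ' : HasFDerivAt (fderiv ℝ ψ) (fderiv ℝ (fderiv ℝ ψ) q) q :=
    (((H.smooth q hq).fderiv_right (m := ∞) (by simp)).differentiableAt (by simp)).hasFDerivAt
  have hh : HasFDerivAt (fun q => h (ψ q)) ((fderiv ℝ h (ψ q)).comp (fderiv ℝ ψ q)) q :=
    ((H.smooth_target q hq).differentiableAt (by simp)).hasFDerivAt.comp q hψ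
  have key := (hh.clm_apply (hψ'.clm_apply (hasFDerivAt_const v q))).clm_apply
    (hψ'.clm_apply (hasFDerivAt_const w q))
  have hev : (fun q => g q v w) =ᶠ[nhds q]
      fun q => h (ψ q) (fderiv ℝ ψ q v) (fderiv ℝ ψ q w) := by
    filter_upwards [H.isOpen.mem_nhds hq] with q' hq' using H.pullback q' hq' v w
  rw [hev.fderiv_eq, key.fderiv]
  simp
  ring

theorem second_symm (H : IsLocalIsometryOn g h ψ U) {q : E} (hq : q ∈ U) (u v : E) :
    fderiv ℝ (fderiv ℝ ψ) q u v = fderiv ℝ (fderiv ℝ ψ) q v u :=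
  ((H.smooth q hq).isSymmSndFDerivAt minSmoothness_two_le).eq u v

/-- The transformation rule of Christoffel symbols. -/
theorem christoffel_source (H : IsLocalIsometryOn g h ψ U) {q : E} (hq : q ∈ U) (u v : E) :
    fderiv ℝ ψ q (christoffel g q u v) =
      christoffel h (ψ q) (fderiv ℝ ψ q u) (fderiv ℝ ψ q v) + fderiv ℝ (fderiv ℝ ψ) q u v := by
  apply (H.nondegenerate_target q hq).injective
  ext y
  obtain ⟨w, rfl⟩ := (H.immersive q hq).surjective y
  rw [← H.pullback q hq, apply_christoffel (H.nondegenerate_source q hq), map_add,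
    _root_.add_apply, apply_christoffel (H.nondegenerate_target q hq), koszul_apply, koszul_apply,
    H.fderiv_source hq, H.fderiv_source hq, H.fderiv_source hq, H.second_symm hq v u,
    H.second_symm hq w u, H.second_symm hq w v,
    H.symm q hq (fderiv ℝ ψ q u) (fderiv ℝ (fderiv ℝ ψ) q v w),
    H.symm q hq (fderiv ℝ ψ q v) (fderiv ℝ (fderiv ℝ ψ) q u w)]
  ring


theorem differentiableAt_source [CompleteSpace E] (H : IsLocalIsometryOn g h ψ U) {q : E}
    (hq : q ∈ U) :
    DifferentiableAt ℝ (christoffelL g) q :=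
  (contDiffAt_christoffelL (H.smooth_source q hq)
    (H.nondegenerate_source q hq)).differentiableAt (by simp)

theorem differentiableAt_target [CompleteSpace F] (H : IsLocalIsometryOn g h ψ U) {q : E}
    (hq : q ∈ U) :
    DifferentiableAt ℝ (christoffelL h) (ψ q) :=
  (contDiffAt_christoffelL (H.smooth_target q hq)
    (H.nondegenerate_target q hq)).differentiableAt (by simp)

/-- The derivative of the transformation rule `christoffel_source`. -/
theorem fderiv_christoffel_source [CompleteSpace E] [CompleteSpace F]
    (H : IsLocalIsometryOn g h ψ U) {q : E} (hq : q ∈ U)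
    (u v w : E) :
    fderiv ℝ (fderiv ℝ ψ) q u (christoffel g q v w) +
        fderiv ℝ ψ q (fderiv ℝ (fun q => christoffel g q v w) q u) =
      fderiv ℝ (fun y => christoffel h y (fderiv ℝ ψ q v) (fderiv ℝ ψ q w)) (ψ q)
        (fderiv ℝ ψ q u) +
      christoffelL h (ψ q) (fderiv ℝ (fderiv ℝ ψ) q u v) (fderiv ℝ ψ q w) +
      christoffelL h (ψ q) (fderiv ℝ ψ q v) (fderiv ℝ (fderiv ℝ ψ) q u w) +
      fderiv ℝ (fderiv ℝ (fderiv ℝ ψ)) q u v w := by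
  have hψ : HasFDerivAt ψ (fderiv ℝ ψ q) q :=
    ((H.smooth q hq).differentiableAt (by simp)).hasFDerivAt
  have c1 : ContDiffAt ℝ ∞ (fderiv ℝ ψ) q := (H.smooth q hq).fderiv_right (by simp)
  have c2 : ContDiffAt ℝ ∞ (fderiv ℝ (fderiv ℝ ψ)) q := c1.fderiv_right (by simp)
  have hψ' := (c1.differentiableAt (by simp)).hasFDerivAt
  have hψ'' := (c2.differentiableAt (by simp)).hasFDerivAt
  have hh := (H.differentiableAt_target hq).hasFDerivAt.comp q hψ
  have hg := (H.differentiableAt_source hq).hasFDerivAt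
  have cv := hasFDerivAt_const (𝕜 := ℝ) v q
  have cw := hasFDerivAt_const (𝕜 := ℝ) w q
  have hl := hψ'.clm_apply ((hg.clm_apply cv).clm_apply cw)
  have hr := ((hh.clm_apply (hψ'.clm_apply cv)).clm_apply (hψ'.clm_apply cw)).add
    ((hψ''.clm_apply cv).clm_apply cw)
  have hev : (fun q => fderiv ℝ ψ q (christoffelL g q v w)) =ᶠ[nhds q]
      fun q => christoffelL h (ψ q) (fderiv ℝ ψ q v) (fderiv ℝ ψ q w) +
        fderiv ℝ (fderiv ℝ ψ) q v w := by
    filter_upwards [H.isOpen.mem_nhds hq] with q' hq'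
    rw [christoffelL_apply, christoffelL_apply, H.christoffel_source hq']
  have := DFunLike.congr_fun (hl.unique (hr.congr_of_eventuallyEq hev)) u
  rw [fderiv_christoffel (H.differentiableAt_source hq),
    fderiv_christoffel (H.differentiableAt_target hq)]
  simp only [christoffelL_apply, _root_.add_apply, ContinuousLinearMap.comp_apply,
    ContinuousLinearMap.flip_apply, Function.comp_apply, _root_.zero_apply, map_zero,
    zero_add] at this ⊢
  rw [add_comm, this]
  abel

/-- In the antisymmetrization of `fderiv_christoffel_source` the third derivative of `ψ` drops out,
and the products of Christoffel symbols absorb the second derivatives. -/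
theorem riemann_source [CompleteSpace E] [CompleteSpace F] (H : IsLocalIsometryOn g h ψ U) {q : E}
    (hq : q ∈ U) (u v w : E) :
    fderiv ℝ ψ q (riemann g q u v w) =
      riemann h (ψ q) (fderiv ℝ ψ q u) (fderiv ℝ ψ q v) (fderiv ℝ ψ q w) := by
  have e1 := H.fderiv_christoffel_source hq u v w
  have e2 := H.fderiv_christoffel_source hq v u w
  have c1 : ContDiffAt ℝ ∞ (fderiv ℝ ψ) q := (H.smooth q hq).fderiv_right (by simp)
  have hs : fderiv ℝ (fderiv ℝ (fderiv ℝ ψ)) q u v w =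
      fderiv ℝ (fderiv ℝ (fderiv ℝ ψ)) q v u w := by
    rw [(c1.isSymmSndFDerivAt minSmoothness_two_le).eq u v]
  rw [← eq_sub_iff_add_eq'] at e1 e2
  rw [riemann, map_sub, map_add, map_sub, e1, e2, H.christoffel_source hq, H.christoffel_source hq,
    H.christoffel_source hq, H.christoffel_source hq, riemann, hs, H.second_symm hq v u]
  simp only [← christoffelL_apply, map_add]
  abel

end IsLocalIsometryOn

/-- Local isometries preserve the Ricci tensor. -/
theorem IsLocalIsometryOn.ricci_source [FiniteDimensional ℝ E] [FiniteDimensional ℝ F]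
    {g : E → E →L[ℝ] E →L[ℝ] ℝ} {h : F → F →L[ℝ] F →L[ℝ] ℝ} {ψ : E → F} {U : Set E}
    (H : IsLocalIsometryOn g h ψ U) {q : E} (hq : q ∈ U) (v w : E) :
    ricci g q v w = ricci h (ψ q) (fderiv ℝ ψ q v) (fderiv ℝ ψ q w) := by
  have := FiniteDimensional.complete ℝ E
  have := FiniteDimensional.complete ℝ F
  obtain ⟨e, he⟩ := H.immersive q hq
  have hE := H.differentiableAt_source hq
  have hF := H.differentiableAt_target hq
  rw [ricci_eq_trace hE, ricci_eq_trace hF, ← LinearMap.trace_conj' _ e.toLinearEquiv]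
  congr 1
  ext y
  obtain ⟨u, rfl⟩ := e.surjective y
  have hu := H.riemann_source hq u v w
  rw [← riemannL_apply hE, ← riemannL_apply hF, ← he] at hu
  rw [← he]
  simpa [LinearEquiv.conj_apply] using hu

end Naturality

/-! ### Action-angle metrics whose Hessian has a diagonal variable part -/

/-- When every endomorphism `Γ(·, w)` is trace free, the Ricci tensor reduces to two terms.
Geometrically, the Riemannian volume is then locally a constant multiple of the coordinate one. -/
theorem ricci_eq_of_christoffel_traceFree {E ι : Type*} [NormedAddCommGroup E] [NormedSpace ℝ E]
    [FiniteDimensional ℝ E] [Fintype ι] (β : Module.Basis ι ℝ E)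
    {g : E → E →L[ℝ] E →L[ℝ] ℝ} {p : E} (hd : DifferentiableAt ℝ (christoffelL g) p)
    (htr : ∀ᶠ q in nhds p, ∀ w, ∑ i, β.coord i (christoffel g q (β i) w) = 0) (v w : E) :
    ricci g p v w = ∑ i, β.coord i (fderiv ℝ (fun q => christoffel g q v w) p (β i)) -
      ∑ i, β.coord i (christoffel g p v (christoffel g p (β i) w)) := by
  rw [ricci_eq_sum β hd]
  have h3 := htr.self_of_nhds (christoffel g p v w)
  have h2 : ∑ i, β.coord i (fderiv ℝ (fun q => christoffel g q (β i) w) p v) = 0 := by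
    let c : ι → E →L[ℝ] ℝ := fun i => LinearMap.toContinuousLinearMap (β.coord i)
    have hdi : ∀ i, HasFDerivAt (fun q => c i (christoffel g q (β i) w))
        ((c i).comp (fderiv ℝ (fun q => christoffel g q (β i) w) p)) p := by
      intro i
      refine (c i).hasFDerivAt.comp p (DifferentiableAt.hasFDerivAt ?_)
      simp only [← christoffelL_apply]
      exact (hd.clm_apply (differentiableAt_const _)).clm_apply (differentiableAt_const _)
    have hs := HasFDerivAt.fun_sum (u := Finset.univ) fun i _ => hdi i
    have hz : (fun q => ∑ i, c i (christoffel g q (β i) w)) =ᶠ[nhds p] fun _ => 0 := by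
      filter_upwards [htr] with q hq using hq w
    have := DFunLike.congr_fun
      (hs.unique ((hasFDerivAt_const (0 : ℝ) p).congr_of_eventuallyEq hz)) v
    simpa [c] using this
  simp only [riemann, map_sub, map_add, Finset.sum_sub_distrib, Finset.sum_add_distrib, h2, h3]
  ring

section ActionAngle

variable {ι : Type*} [Fintype ι] [DecidableEq ι]

/-- The Hessian `diag (φᵢ(xᵢ)) + B` of a symplectic potential. -/
def hess (φ : ι → ℝ → ℝ) (B : Matrix ι ι ℝ) (x : ι → ℝ) : Matrix ι ι ℝ :=
  Matrix.diagonal (fun i => φ i (x i)) + B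

/-- The coordinate one-form `dxᵢ` of the action-angle space. -/
def actionForm (i : ι) : (ι → ℝ) × (ι → ℝ) →L[ℝ] ℝ :=
  (ContinuousLinearMap.proj i).comp (ContinuousLinearMap.fst ℝ _ _)

/-- The coordinate one-form `dθᵢ` of the action-angle space. -/
def angleForm (i : ι) : (ι → ℝ) × (ι → ℝ) →L[ℝ] ℝ :=
  (ContinuousLinearMap.proj i).comp (ContinuousLinearMap.snd ℝ _ _)

/-- The metric `ᵗdx G dx + ᵗdθ G⁻¹ dθ` in action-angle coordinates `(x, θ)`, where
`G = diag (φᵢ(xᵢ)) + B`. -/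
def actionAngleMetric (φ : ι → ℝ → ℝ) (B : Matrix ι ι ℝ) (z : (ι → ℝ) × (ι → ℝ)) :
    (ι → ℝ) × (ι → ℝ) →L[ℝ] (ι → ℝ) × (ι → ℝ) →L[ℝ] ℝ :=
  tensorForm (hess φ B z.1) actionForm + tensorForm (hess φ B z.1)⁻¹ angleForm

/-- `hess φ B` is smooth and positive definite on the open set `V`, the derivative of `φᵢ` is
`-aᵢ`, and that of `aᵢ` is `bᵢ`. -/
structure IsHessianOn (φ a b : ι → ℝ → ℝ) (B : Matrix ι ι ℝ) (V : Set (ι → ℝ)) : Prop where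
  isOpen : IsOpen V
  smooth : ∀ x ∈ V, ∀ i, ContDiffAt ℝ ∞ (φ i) (x i)
  deriv : ∀ x ∈ V, ∀ i, HasDerivAt (φ i) (-a i (x i)) (x i)
  deriv₂ : ∀ x ∈ V, ∀ i, HasDerivAt (a i) (b i (x i)) (x i)
  posDef : ∀ x ∈ V, (hess φ B x).PosDef

variable {φ a b : ι → ℝ → ℝ} {B : Matrix ι ι ℝ} {V : Set (ι → ℝ)}

theorem hess_eq_sum (x : ι → ℝ) :
    hess φ B x = ∑ i, φ i (x i) • Matrix.single i i (1 : ℝ) + B := by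
  rw [hess]
  congr 1
  ext i j
  simp only [Matrix.sum_apply, Matrix.smul_apply, Matrix.single_apply, Matrix.diagonal_apply]
  by_cases h : i = j
  · subst h; simp
  · simp only [h, if_false]
    refine (Finset.sum_eq_zero fun k _ => ?_).symm
    rw [if_neg (fun hk => h (hk.1.symm.trans hk.2)), smul_zero]

section Inverse

-- a normed ring structure on matrices, for the smoothness of the matrix inverse
open scoped Matrix.Norms.Operator

theorem inv_hess_eq (i j : ι) : (fun z : (ι → ℝ) × (ι → ℝ) => (hess φ B z.1)⁻¹ i j) =
    (LinearMap.toContinuousLinearMap (Matrix.entryLinearMap ℝ ℝ i j)) ∘ Ring.inverse ∘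
      fun z : (ι → ℝ) × (ι → ℝ) => ∑ i, φ i (z.1 i) • Matrix.single i i (1 : ℝ) + B := by
  funext z
  simp only [hess_eq_sum, Matrix.nonsing_inv_eq_ringInverse]
  rfl

theorem IsHessianOn.contDiffAt_inv (H : IsHessianOn φ a b B V) {z : (ι → ℝ) × (ι → ℝ)}
    (hz : z.1 ∈ V) (i j : ι) :
    ContDiffAt ℝ ∞ (fun z : (ι → ℝ) × (ι → ℝ) => (hess φ B z.1)⁻¹ i j) z := by
  obtain ⟨u, hu⟩ := (H.posDef _ hz).isUnit
  rw [hess_eq_sum] at hu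
  rw [inv_hess_eq]
  refine (ContinuousLinearMap.contDiff _).contDiffAt.comp z (ContDiffAt.comp z ?_ ?_)
  · rw [← hu]
    exact contDiffAt_ringInverse ℝ u
  · refine ContDiffAt.add (ContDiffAt.sum fun k _ => ?_) contDiffAt_const
    have h : ContDiffAt ℝ ∞ (fun z : (ι → ℝ) × (ι → ℝ) => φ k (z.1 k)) z :=
      (H.smooth _ hz k).comp z (actionForm k).contDiff.contDiffAt
    exact h.smul contDiffAt_const

end Inverse

theorem IsHessianOn.hess_mul_inv (H : IsHessianOn φ a b B V) {x : ι → ℝ} (hx : x ∈ V) :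
    hess φ B x * (hess φ B x)⁻¹ = 1 :=
  Matrix.mul_nonsing_inv _ ((Matrix.isUnit_iff_isUnit_det _).1 (H.posDef x hx).isUnit)

theorem IsHessianOn.inv_mul_hess (H : IsHessianOn φ a b B V) {x : ι → ℝ} (hx : x ∈ V) :
    (hess φ B x)⁻¹ * hess φ B x = 1 :=
  Matrix.nonsing_inv_mul _ ((Matrix.isUnit_iff_isUnit_det _).1 (H.posDef x hx).isUnit)

theorem IsHessianOn.eventually_mem (H : IsHessianOn φ a b B V) {z : (ι → ℝ) × (ι → ℝ)}
    (hz : z.1 ∈ V) : ∀ᶠ y : (ι → ℝ) × (ι → ℝ) in nhds z, y.1 ∈ V :=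
  continuousAt_fst.eventually_mem (H.isOpen.mem_nhds hz)

theorem IsHessianOn.hasFDerivAt_hess (H : IsHessianOn φ a b B V) {z : (ι → ℝ) × (ι → ℝ)}
    (hz : z.1 ∈ V) (i j : ι) :
    HasFDerivAt (fun z : (ι → ℝ) × (ι → ℝ) => hess φ B z.1 i j)
      ((Matrix.diagonal (fun k => -a k (z.1 k)) i j) • actionForm i) z := by
  simp only [hess, Matrix.add_apply, Matrix.diagonal_apply]
  split_ifs with h
  · exact ((H.deriv _ hz i).comp_hasFDerivAt z (actionForm i).hasFDerivAt).add_const _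
  · simpa using hasFDerivAt_const (B i j) z

/-- The derivative of `G⁻¹` is `-G⁻¹ (dG) G⁻¹`. -/
theorem IsHessianOn.hasFDerivAt_inv (H : IsHessianOn φ a b B V) {z : (ι → ℝ) × (ι → ℝ)}
    (hz : z.1 ∈ V) (i j : ι) :
    HasFDerivAt (fun z : (ι → ℝ) × (ι → ℝ) => (hess φ B z.1)⁻¹ i j)
      (∑ k, ((hess φ B z.1)⁻¹ i k * a k (z.1 k) * (hess φ B z.1)⁻¹ k j) • actionForm k) z := by
  have hd : ∀ i j, HasFDerivAt (fun z : (ι → ℝ) × (ι → ℝ) => (hess φ B z.1)⁻¹ i j)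
      (fderiv ℝ (fun z : (ι → ℝ) × (ι → ℝ) => (hess φ B z.1)⁻¹ i j) z) z := fun i j =>
    ((H.contDiffAt_inv hz i j).differentiableAt (by simp)).hasFDerivAt
  refine (hd i j).congr_fderiv (ContinuousLinearMap.ext fun v => ?_)
  obtain ⟨D, hD⟩ : ∃ D : Matrix ι ι ℝ, ∀ i j,
      D i j = fderiv ℝ (fun z : (ι → ℝ) × (ι → ℝ) => (hess φ B z.1)⁻¹ i j) z v :=
    ⟨Matrix.of fun i j => _, fun i j => rfl⟩
  have hGD : hess φ B z.1 * D =
      Matrix.diagonal (fun k => a k (z.1 k) * v.1 k) * (hess φ B z.1)⁻¹ := by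
    ext p q
    have h1 := HasFDerivAt.fun_sum (u := Finset.univ) fun k _ =>
      (H.hasFDerivAt_hess hz p k).mul (hd k q)
    have h2 : (fun z : (ι → ℝ) × (ι → ℝ) => ∑ k, hess φ B z.1 p k * (hess φ B z.1)⁻¹ k q)
        =ᶠ[nhds z] fun _ => (1 : Matrix ι ι ℝ) p q := by
      filter_upwards [H.eventually_mem hz] with y hy
      rw [← H.hess_mul_inv hy, Matrix.mul_apply]
    have h3 := DFunLike.congr_fun
      (h1.unique ((hasFDerivAt_const ((1 : Matrix ι ι ℝ) p q) z).congr_of_eventuallyEq h2)) v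
    simp only [_root_.sum_apply, _root_.add_apply, _root_.smul_apply, smul_eq_mul, ← hD,
      Finset.sum_add_distrib, _root_.zero_apply] at h3
    rw [Matrix.mul_apply, Matrix.diagonal_mul]
    have h4 : ∑ x, (hess φ B z.1)⁻¹ x q *
        (Matrix.diagonal (fun k => -a k (z.1 k)) p x * actionForm p v) =
        -(a p (z.1 p) * v.1 p * (hess φ B z.1)⁻¹ p q) := by
      rw [Finset.sum_eq_single p]
      · simp [actionForm]; ring
      · intro k _ hk
        simp [Matrix.diagonal_apply_ne' _ hk]
      · simp
    linarith
  have h5 : D = (hess φ B z.1)⁻¹ *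
      (Matrix.diagonal (fun k => a k (z.1 k) * v.1 k) * (hess φ B z.1)⁻¹) := by
    rw [← hGD, ← Matrix.mul_assoc, H.inv_mul_hess hz, Matrix.one_mul]
  rw [← hD, h5, Matrix.mul_apply]
  simp only [_root_.sum_apply, _root_.smul_apply, Matrix.diagonal_mul, smul_eq_mul, actionForm,
    ContinuousLinearMap.comp_apply, ContinuousLinearMap.proj_apply, ContinuousLinearMap.coe_fst']
  refine Finset.sum_congr rfl fun k _ => ?_
  ring

theorem actionAngleMetric_apply (z v w : (ι → ℝ) × (ι → ℝ)) :
    actionAngleMetric φ B z v w = dotProduct v.1 ((hess φ B z.1).mulVec w.1) +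
      dotProduct v.2 ((hess φ B z.1)⁻¹.mulVec w.2) := by
  rw [actionAngleMetric, _root_.add_apply, _root_.add_apply, tensorForm_apply, tensorForm_apply]
  rfl

theorem IsHessianOn.contDiffAt_metric (H : IsHessianOn φ a b B V) {z : (ι → ℝ) × (ι → ℝ)}
    (hz : z.1 ∈ V) : ContDiffAt ℝ ∞ (actionAngleMetric φ B) z := by
  unfold actionAngleMetric tensorForm
  refine ContDiffAt.add (ContDiffAt.sum fun i _ => ContDiffAt.sum fun j _ => ?_)
    (ContDiffAt.sum fun i _ => ContDiffAt.sum fun j _ => ?_)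
  · have h : ContDiffAt ℝ ∞ (fun z : (ι → ℝ) × (ι → ℝ) => hess φ B z.1 i j) z := by
      simp only [hess, Matrix.add_apply, Matrix.diagonal_apply]
      split_ifs
      · exact ((H.smooth _ hz i).comp z (actionForm i).contDiff.contDiffAt).add contDiffAt_const
      · exact contDiffAt_const
    exact h.smul contDiffAt_const
  · exact (H.contDiffAt_inv hz i j).smul contDiffAt_const

theorem IsHessianOn.transpose_inv (H : IsHessianOn φ a b B V) {x : ι → ℝ} (hx : x ∈ V) :
    (hess φ B x)⁻¹.transpose = (hess φ B x)⁻¹ := by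
  have := (H.posDef x hx).inv.isHermitian
  rwa [Matrix.IsHermitian, Matrix.conjTranspose_eq_transpose_of_trivial] at this

theorem IsHessianOn.transpose_hess (H : IsHessianOn φ a b B V) {x : ι → ℝ} (hx : x ∈ V) :
    (hess φ B x).transpose = hess φ B x := by
  have := (H.posDef x hx).isHermitian
  rwa [Matrix.IsHermitian, Matrix.conjTranspose_eq_transpose_of_trivial] at this

theorem IsHessianOn.inv_symm (H : IsHessianOn φ a b B V) {x : ι → ℝ} (hx : x ∈ V) (i j : ι) :
    (hess φ B x)⁻¹ i j = (hess φ B x)⁻¹ j i :=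
  congrFun (congrFun (H.transpose_inv hx).symm i) j

theorem dotProduct_mulVec_comm_of_symm {M : Matrix ι ι ℝ} (hM : M.transpose = M) (u v : ι → ℝ) :
    dotProduct u (M.mulVec v) = dotProduct (M.mulVec u) v := by
  rw [Matrix.dotProduct_mulVec, ← Matrix.mulVec_transpose, hM]

theorem IsHessianOn.metric_symm (H : IsHessianOn φ a b B V) {z : (ι → ℝ) × (ι → ℝ)}
    (hz : z.1 ∈ V) (v w : (ι → ℝ) × (ι → ℝ)) :
    actionAngleMetric φ B z v w = actionAngleMetric φ B z w v := by
  rw [actionAngleMetric_apply, actionAngleMetric_apply,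
    dotProduct_mulVec_comm_of_symm (H.transpose_hess hz),
    dotProduct_mulVec_comm_of_symm (H.transpose_inv hz), dotProduct_comm _ w.1,
    dotProduct_comm _ w.2]

theorem IsHessianOn.metric_pos (H : IsHessianOn φ a b B V) {z : (ι → ℝ) × (ι → ℝ)}
    (hz : z.1 ∈ V) {v : (ι → ℝ) × (ι → ℝ)} (hv : v ≠ 0) : 0 < actionAngleMetric φ B z v v := by
  rw [actionAngleMetric_apply]
  have h1 : 0 ≤ dotProduct v.1 ((hess φ B z.1).mulVec v.1) := by
    simpa using (H.posDef _ hz).posSemidef.dotProduct_mulVec_nonneg v.1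
  have h2 : 0 ≤ dotProduct v.2 ((hess φ B z.1)⁻¹.mulVec v.2) := by
    simpa using (H.posDef _ hz).inv.posSemidef.dotProduct_mulVec_nonneg v.2
  by_cases h : v.1 = 0
  · have h' : v.2 ≠ 0 := fun h' => hv (Prod.ext h h')
    have := (H.posDef _ hz).inv.dotProduct_mulVec_pos h'
    rw [star_trivial] at this
    linarith
  · have := (H.posDef _ hz).dotProduct_mulVec_pos h
    rw [star_trivial] at this
    linarith

theorem IsHessianOn.metric_isInvertible (H : IsHessianOn φ a b B V) {z : (ι → ℝ) × (ι → ℝ)}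
    (hz : z.1 ∈ V) : (actionAngleMetric φ B z).IsInvertible :=
  isInvertible_of_pos fun _ hv => H.metric_pos hz hv

theorem IsHessianOn.hasFDerivAt_inv_mulVec (H : IsHessianOn φ a b B V) {z : (ι → ℝ) × (ι → ℝ)}
    (hz : z.1 ∈ V) (t : ι → ℝ) (i : ι) :
    HasFDerivAt (fun z : (ι → ℝ) × (ι → ℝ) => (hess φ B z.1)⁻¹.mulVec t i)
      (∑ k, ((hess φ B z.1)⁻¹ i k * a k (z.1 k) * (hess φ B z.1)⁻¹.mulVec t k) • actionForm k)
      z := by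
  simp only [Matrix.mulVec, dotProduct]
  refine (HasFDerivAt.fun_sum (u := Finset.univ) fun j _ =>
    (H.hasFDerivAt_inv hz i j).mul_const (t j)).congr_fderiv (ContinuousLinearMap.ext fun v => ?_)
  simp only [_root_.sum_apply, _root_.smul_apply, smul_eq_mul, Finset.mul_sum, Finset.sum_mul]
  rw [Finset.sum_comm]
  refine Finset.sum_congr rfl fun k _ => Finset.sum_congr rfl fun j _ => ?_
  ring

theorem IsHessianOn.fderiv_metric (H : IsHessianOn φ a b B V) {z : (ι → ℝ) × (ι → ℝ)}
    (hz : z.1 ∈ V) (u v w : (ι → ℝ) × (ι → ℝ)) :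
    fderiv ℝ (actionAngleMetric φ B) z u v w =
      ∑ k, a k (z.1 k) * (u.1 k * ((hess φ B z.1)⁻¹.mulVec v.2 k * (hess φ B z.1)⁻¹.mulVec w.2 k
        - v.1 k * w.1 k)) := by
  rw [fderiv_apply_apply ((H.contDiffAt_metric hz).differentiableAt (by simp))]
  simp only [actionAngleMetric_apply]
  have h1 := HasFDerivAt.fun_sum (u := Finset.univ) fun i _ =>
    (HasFDerivAt.fun_sum (u := Finset.univ) fun j _ =>
      (H.hasFDerivAt_hess hz i j).mul_const (w.1 j)).const_mul (v.1 i)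
  have h2 := HasFDerivAt.fun_sum (u := Finset.univ) fun i _ =>
    (H.hasFDerivAt_inv_mulVec hz w.2 i).const_mul (v.2 i)
  have h3 : HasFDerivAt (fun q : (ι → ℝ) × (ι → ℝ) => dotProduct v.1 ((hess φ B q.1).mulVec w.1) +
    dotProduct v.2 ((hess φ B q.1)⁻¹.mulVec w.2)) _ z := h1.add h2
  rw [h3.fderiv]
  simp only [_root_.sum_apply, _root_.add_apply, _root_.smul_apply, smul_eq_mul, mul_sub,
    Finset.sum_sub_distrib]
  have e1 : ∑ x, v.1 x * ∑ y, w.1 y * (Matrix.diagonal (fun k => -a k (z.1 k)) x y *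
      actionForm x u) = -∑ k, a k (z.1 k) * (u.1 k * (v.1 k * w.1 k)) := by
    rw [← Finset.sum_neg_distrib]
    refine Finset.sum_congr rfl fun k _ => ?_
    rw [Finset.sum_eq_single k]
    · simp [actionForm]; ring
    · intro l _ hl
      simp [Matrix.diagonal_apply_ne' _ hl]
    · simp
  have e2 : ∑ x, v.2 x * ∑ k, (hess φ B z.1)⁻¹ x k * a k (z.1 k) *
      (hess φ B z.1)⁻¹.mulVec w.2 k * actionForm k u = ∑ k, a k (z.1 k) *
      (u.1 k * ((hess φ B z.1)⁻¹.mulVec v.2 k * (hess φ B z.1)⁻¹.mulVec w.2 k)) := by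
    simp only [Finset.mul_sum]
    rw [Finset.sum_comm]
    refine Finset.sum_congr rfl fun k _ => ?_
    have : (hess φ B z.1)⁻¹.mulVec v.2 k = ∑ x, (hess φ B z.1)⁻¹ x k * v.2 x := by
      simp only [Matrix.mulVec, dotProduct, H.inv_symm hz k]
    rw [this]
    simp only [Finset.mul_sum, Finset.sum_mul]
    refine Finset.sum_congr rfl fun x _ => ?_
    simp [actionForm]; ring
  rw [e1, e2]
  ring

/-- The components of `Γ(v, w)` in the action and angle directions; the angular components of `v`
and `w` enter through `G⁻¹` only. -/
theorem IsHessianOn.christoffel_metric (H : IsHessianOn φ a b B V) {z : (ι → ℝ) × (ι → ℝ)}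
    (hz : z.1 ∈ V) (v w : (ι → ℝ) × (ι → ℝ)) :
    christoffel (actionAngleMetric φ B) z v w =
      ((hess φ B z.1)⁻¹.mulVec fun k => -(1 / 2) * (a k (z.1 k) * (v.1 k * w.1 k +
        (hess φ B z.1)⁻¹.mulVec v.2 k * (hess φ B z.1)⁻¹.mulVec w.2 k)),
      fun k => 1 / 2 * (a k (z.1 k) * (v.1 k * (hess φ B z.1)⁻¹.mulVec w.2 k +
        w.1 k * (hess φ B z.1)⁻¹.mulVec v.2 k))) := by
  refine christoffel_eq_of_apply (H.metric_isInvertible hz) fun y => ?_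
  rw [actionAngleMetric_apply, koszul_apply, H.fderiv_metric hz, H.fderiv_metric hz,
    H.fderiv_metric hz, dotProduct_mulVec_comm_of_symm (H.transpose_hess hz), Matrix.mulVec_mulVec,
    H.hess_mul_inv hz, Matrix.one_mulVec]
  simp only [dotProduct, ← Finset.sum_add_distrib, ← Finset.sum_sub_distrib, Finset.mul_sum]
  refine Finset.sum_congr rfl fun k _ => ?_
  ring

/-- The value `Ric(v, v)` of the Ricci tensor of an action-angle metric on a vector
`v = (c, 0)`, as a function of `c`. By invariance under the complex structure, the same function
of `c = G⁻¹ t` is the value on `(0, t)`. -/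
def ricciForm (F : Matrix ι ι ℝ) (α β c : ι → ℝ) : ℝ :=
  -(1 / 2) * (∑ k, ∑ l, α k * α l * F k k * F k l * c l ^ 2 + ∑ k, F k k * β k * c k ^ 2 +
    ∑ k, ∑ l, F k l ^ 2 * α k * α l * c k * c l)

/-- The standard basis of the action-angle space. -/
def actionAngleBasis (ι : Type*) [Fintype ι] [DecidableEq ι] :
    Module.Basis (ι ⊕ ι) ℝ ((ι → ℝ) × (ι → ℝ)) :=
  (Pi.basisFun ℝ ι).prod (Pi.basisFun ℝ ι)

theorem sum_coord_actionAngleBasis (f : (ι → ℝ) × (ι → ℝ) → (ι → ℝ) × (ι → ℝ)) :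
    ∑ i, (actionAngleBasis ι).coord i (f (actionAngleBasis ι i)) =
      ∑ k, (f (Pi.single k 1, 0)).1 k + ∑ k, (f (0, Pi.single k 1)).2 k := by
  simp [actionAngleBasis, Fintype.sum_sum_type, Module.Basis.coord_apply]

/-- The action part `-½ ∑ Fₖₖ aₖ cₖ` and the angle part `½ ∑ aₖ cₖ Fₖₖ` of the trace cancel. -/
theorem IsHessianOn.christoffel_traceFree (H : IsHessianOn φ a b B V) {z : (ι → ℝ) × (ι → ℝ)}
    (hz : z.1 ∈ V) (w : (ι → ℝ) × (ι → ℝ)) :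
    ∑ i, (actionAngleBasis ι).coord i
      (christoffel (actionAngleMetric φ B) z (actionAngleBasis ι i) w) = 0 := by
  rw [sum_coord_actionAngleBasis fun u => christoffel (actionAngleMetric φ B) z u w,
    ← Finset.sum_add_distrib]
  refine Finset.sum_eq_zero fun k _ => ?_
  simp only [H.christoffel_metric hz, Matrix.mulVec_zero, Pi.zero_apply, zero_mul, add_zero,
    zero_add, Matrix.mulVec_single_one, Matrix.col_apply]
  rw [Matrix.mulVec, dotProduct, Finset.sum_eq_single k]
  · simp; ring
  · intro l _ hl
    simp [hl]
  · simp

theorem IsHessianOn.differentiableAt_christoffelL (H : IsHessianOn φ a b B V)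
    {z : (ι → ℝ) × (ι → ℝ)} (hz : z.1 ∈ V) :
    DifferentiableAt ℝ (christoffelL (actionAngleMetric φ B)) z :=
  (contDiffAt_christoffelL (H.contDiffAt_metric hz) (H.metric_isInvertible hz)).differentiableAt
    (by simp)

/-- The coordinate divergence of the vector field `Γ(v, v)` for a constant vector field `v`. -/
theorem IsHessianOn.divergence_christoffel (H : IsHessianOn φ a b B V)
    {z : (ι → ℝ) × (ι → ℝ)} (hz : z.1 ∈ V) (v : (ι → ℝ) × (ι → ℝ)) {F : Matrix ι ι ℝ}
    (hF : F = (hess φ B z.1)⁻¹) {α β t : ι → ℝ} (hα : α = fun k => a k (z.1 k))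
    (hβ : β = fun k => b k (z.1 k)) (ht : t = F.mulVec v.2) :
    ∑ i, (actionAngleBasis ι).coord i
      (fderiv ℝ (fun q => christoffel (actionAngleMetric φ B) q v v) z (actionAngleBasis ι i)) =
    -(1 / 2) * (∑ k, ∑ l, α k * α l * F k k * F k l * (v.1 l ^ 2 + t l ^ 2) +
      ∑ k, F k k * β k * (v.1 k ^ 2 + t k ^ 2) +
      2 * ∑ k, ∑ l, F k l ^ 2 * α k * α l * t k * t l) := by
  have hd : HasFDerivAt (fun q => christoffel (actionAngleMetric φ B) q v v)
      (fderiv ℝ (fun q => christoffel (actionAngleMetric φ B) q v v) z) z := by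
    refine DifferentiableAt.hasFDerivAt ?_
    simp only [← christoffelL_apply]
    exact ((H.differentiableAt_christoffelL hz).clm_apply (differentiableAt_const _)).clm_apply
      (differentiableAt_const _)
  have ha : ∀ k, HasFDerivAt (fun q : (ι → ℝ) × (ι → ℝ) => a k (q.1 k)) (β k • actionForm k) z := by
    intro k
    rw [hβ]
    exact (H.deriv₂ _ hz k).comp_hasFDerivAt z (actionForm k).hasFDerivAt
  have hat : ∀ i, HasFDerivAt (fun z : (ι → ℝ) × (ι → ℝ) => (hess φ B z.1)⁻¹.mulVec v.2 i)
      (∑ k, (F i k * α k * t k) • actionForm k) z := by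
    intro i
    rw [hα, ht, hF]
    exact H.hasFDerivAt_inv_mulVec hz v.2 i
  have hinv : ∀ i j, HasFDerivAt (fun z : (ι → ℝ) × (ι → ℝ) => (hess φ B z.1)⁻¹ i j)
      (∑ k, (F i k * α k * F k j) • actionForm k) z := by
    intro i j
    rw [hα, hF]
    exact H.hasFDerivAt_inv hz i j
  have hsymm : ∀ i j, F i j = F j i := by
    rw [hF]; exact H.inv_symm hz
  have hev : (fun q => christoffel (actionAngleMetric φ B) q v v) =ᶠ[nhds z] fun q =>
      ((hess φ B q.1)⁻¹.mulVec fun k => -(1 / 2) * (a k (q.1 k) * (v.1 k * v.1 k +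
        (hess φ B q.1)⁻¹.mulVec v.2 k * (hess φ B q.1)⁻¹.mulVec v.2 k)),
      fun k => 1 / 2 * (a k (q.1 k) * (v.1 k * (hess φ B q.1)⁻¹.mulVec v.2 k +
        v.1 k * (hess φ B q.1)⁻¹.mulVec v.2 k))) := by
    filter_upwards [H.eventually_mem hz] with q hq using H.christoffel_metric hq v v
  have hd' := hd.congr_of_eventuallyEq hev.symm
  rw [sum_coord_actionAngleBasis fun u =>
    fderiv ℝ (fun q => christoffel (actionAngleMetric φ B) q v v) z u]
  -- the angular components depend on the actions only
  have hsecond : ∀ k, (fderiv ℝ (fun q => christoffel (actionAngleMetric φ B) q v v) z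
      (0, Pi.single k 1)).2 k = 0 := by
    intro k
    have h1 := (angleForm k).hasFDerivAt.comp z hd'
    have h2 := ((ha k).mul (((hat k).const_mul (v.1 k)).add ((hat k).const_mul (v.1 k)))).const_mul
      (1 / 2 : ℝ)
    have h3 := DFunLike.congr_fun (h1.unique h2) (0, Pi.single k 1)
    refine (show _ = _ from h3).trans ?_
    simp [actionForm]
  have hfirst : ∀ k, (fderiv ℝ (fun q => christoffel (actionAngleMetric φ B) q v v) z
      (Pi.single k 1, 0)).1 k = ∑ l, -(1 / 2) * (α k * α l * F k k * F k l * (v.1 l ^ 2 + t l ^ 2) +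
        2 * (F k l ^ 2 * α k * α l * t k * t l)) -
        1 / 2 * (F k k * β k * (v.1 k ^ 2 + t k ^ 2)) := by
    intro k
    have h1 := (actionForm k).hasFDerivAt.comp z hd'
    have h2 := HasFDerivAt.fun_sum (u := Finset.univ) fun l _ => (hinv k l).mul
      (((ha l).mul (((hat l).mul (hat l)).const_add (v.1 l * v.1 l))).const_mul (-(1 / 2) : ℝ))
    have h3 := DFunLike.congr_fun (h1.unique h2) (Pi.single k 1, 0)
    refine (show _ = _ from h3).trans ?_
    have hαk : ∀ k, a k (z.1 k) = α k := fun k => by rw [hα]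
    have hsingle : ∀ (f : ι → ℝ), (∑ x, f x • (actionForm x : (ι → ℝ) × (ι → ℝ) →L[ℝ] ℝ))
        (Pi.single k 1, 0) = f k := by
      intro f
      simp [actionForm, Pi.single_apply]
    simp only [_root_.sum_apply, _root_.add_apply, _root_.smul_apply, hsingle, ← hF, ← ht, hαk,
      smul_eq_mul, Pi.mul_apply]
    have hdelta : ∀ (f : ι → ℝ), ∑ l, f l * (actionForm l : (ι → ℝ) × (ι → ℝ) →L[ℝ] ℝ)
        (Pi.single k 1, 0) = f k := by
      intro f
      simp [actionForm, Pi.single_apply]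
    rw [← hdelta fun l => 1 / 2 * (F k l * β l * (v.1 l ^ 2 + t l ^ 2)), ← Finset.sum_sub_distrib]
    refine Finset.sum_congr rfl fun l _ => ?_
    rw [hsymm l k]
    ring
  simp only [hfirst, hsecond, Finset.sum_const_zero, add_zero, Finset.sum_sub_distrib,
    Finset.sum_add_distrib, mul_add, ← Finset.mul_sum]
  ring

/-- The Ricci tensor of an action-angle metric. -/
theorem IsHessianOn.ricci_metric (H : IsHessianOn φ a b B V)
    {z : (ι → ℝ) × (ι → ℝ)} (hz : z.1 ∈ V) (v : (ι → ℝ) × (ι → ℝ)) :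
    ricci (actionAngleMetric φ B) z v v =
      ricciForm (hess φ B z.1)⁻¹ (fun k => a k (z.1 k)) (fun k => b k (z.1 k)) v.1 +
      ricciForm (hess φ B z.1)⁻¹ (fun k => a k (z.1 k)) (fun k => b k (z.1 k))
        ((hess φ B z.1)⁻¹.mulVec v.2) := by
  rw [ricci_eq_of_christoffel_traceFree (actionAngleBasis ι) (H.differentiableAt_christoffelL hz)
    (by filter_upwards [H.eventually_mem hz] with q hq using H.christoffel_traceFree hq),
    H.divergence_christoffel hz v rfl rfl rfl rfl,
    sum_coord_actionAngleBasis fun u => christoffel (actionAngleMetric φ B) z v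
      (christoffel (actionAngleMetric φ B) z u v)]
  have hsymm := H.inv_symm hz
  obtain ⟨F, hF⟩ : ∃ F, F = (hess φ B z.1)⁻¹ := ⟨_, rfl⟩
  obtain ⟨α, hα⟩ : ∃ α : ι → ℝ, ∀ k, a k (z.1 k) = α k := ⟨_, fun k => rfl⟩
  obtain ⟨t, ht⟩ : ∃ t, t = F.mulVec v.2 := ⟨_, rfl⟩
  simp only [H.christoffel_metric hz, ← hF, hα, ← ht, Matrix.mulVec_zero] at hsymm ⊢
  have hsingle : ∀ (x : ι) (c : ℝ) (f : ι → ℝ) (l : ι),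
      F.mulVec (fun k => c * (α k * (Pi.single (M := fun _ => ℝ) x 1 k * f k))) l =
        c * α x * F l x * f x := by
    intro x c f l
    rw [Matrix.mulVec, dotProduct, Finset.sum_eq_single x]
    · simp; ring
    · intro k _ hk
      simp [hk]
    · simp
  have hT1 : ∀ x, F.mulVec (fun k => -(1 / 2) * (α k * (v.1 k *
        F.mulVec (fun k => -(1 / 2) * (α k * (Pi.single (M := fun _ => ℝ) x 1 k * v.1 k))) k +
      t k * F.mulVec (fun k => 1 / 2 * (α k * (Pi.single (M := fun _ => ℝ) x 1 k * t k))) k))) x =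
      ∑ l, 1 / 4 * (F x l ^ 2 * α x * α l * v.1 x * v.1 l - F x l ^ 2 * α x * α l * t x * t l) := by
    intro x
    simp only [hsingle]
    rw [Matrix.mulVec, dotProduct]
    refine Finset.sum_congr rfl fun l _ => ?_
    rw [hsymm l x]
    ring
  have hT2 : ∀ x, 1 / 2 * (α x * (v.1 x *
        F.mulVec (fun k => 1 / 2 * (α k * (v.1 k * F k x))) x +
      F.mulVec (fun k => -(1 / 2) * (α k * (F k x * t k))) x * t x)) =
      ∑ l, 1 / 4 * (F x l ^ 2 * α x * α l * v.1 x * v.1 l - F x l ^ 2 * α x * α l * t x * t l) := by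
    intro x
    simp only [Matrix.mulVec, dotProduct, Finset.mul_sum, Finset.sum_mul,
      ← Finset.sum_add_distrib]
    refine Finset.sum_congr rfl fun l _ => ?_
    rw [hsymm l x]
    ring
  simp only [Pi.zero_apply, zero_mul, mul_zero, add_zero, zero_add, Matrix.mulVec_single_one,
    Matrix.col_apply, hT1, hT2]
  simp only [ricciForm, mul_add, mul_sub, Finset.sum_add_distrib, Finset.sum_sub_distrib,
    ← Finset.mul_sum]
  ring

end ActionAngle

/-! ### The lower bound for the Ricci form -/

section Estimate

variable {ι : Type*} [Fintype ι] [DecidableEq ι]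

/-- A positive definite matrix dominates a positive multiple of the identity. -/
theorem exists_pos_mul_le_of_posDef {A : Matrix ι ι ℝ} (hA : A.PosDef) :
    ∃ c > 0, ∀ u : ι → ℝ, c * ∑ i, u i ^ 2 ≤ dotProduct u (A.mulVec u) := by
  have hcont : Continuous fun u : ι → ℝ => dotProduct u (A.mulVec u) := by
    simp only [dotProduct, Matrix.mulVec]
    fun_prop
  have hcont' : Continuous fun u : ι → ℝ => ∑ i, u i ^ 2 := by fun_prop
  rcases (Metric.sphere (0 : ι → ℝ) 1).eq_empty_or_nonempty with h | h
  · refine ⟨1, one_pos, fun u => ?_⟩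
    have hu : u = 0 := by
      by_contra hu
      have : ‖u‖⁻¹ • u ∈ Metric.sphere (0 : ι → ℝ) 1 := by
        simp [norm_smul, norm_ne_zero_iff.2 hu]
      rw [h] at this
      exact this
    simp [hu]
  · obtain ⟨x, hx, hmin⟩ := (isCompact_sphere (0 : ι → ℝ) 1).exists_isMinOn h hcont.continuousOn
    obtain ⟨y, hy, hmax⟩ := (isCompact_sphere (0 : ι → ℝ) 1).exists_isMaxOn h hcont'.continuousOn
    have hx0 : x ≠ 0 := by rintro rfl; simp at hx
    have hq : 0 < dotProduct x (A.mulVec x) := by simpa using hA.dotProduct_mulVec_pos hx0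
    have hS : 0 ≤ ∑ i, y i ^ 2 := Finset.sum_nonneg fun i _ => sq_nonneg _
    refine ⟨dotProduct x (A.mulVec x) / (∑ i, y i ^ 2 + 1), by positivity, fun u => ?_⟩
    by_cases hu : u = 0
    · simp [hu]
    have hn : 0 < ‖u‖ := norm_pos_iff.2 hu
    have hmem : ‖u‖⁻¹ • u ∈ Metric.sphere (0 : ι → ℝ) 1 := by
      simp [norm_smul, hn.ne']
    have h1 : dotProduct x (A.mulVec x) ≤ _ := hmin hmem
    have h2 : ∑ i, (‖u‖⁻¹ • u) i ^ 2 ≤ ∑ i, y i ^ 2 := hmax hmem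
    simp only [Matrix.mulVec_smul, dotProduct_smul, smul_dotProduct, smul_eq_mul] at h1
    simp only [Pi.smul_apply, smul_eq_mul, mul_pow, ← Finset.mul_sum] at h2
    have h3 : ∑ i, u i ^ 2 ≤ ‖u‖ ^ 2 * (∑ i, y i ^ 2 + 1) := by
      have h4 : ∑ i, u i ^ 2 = ‖u‖ ^ 2 * (‖u‖⁻¹ ^ 2 * ∑ i, u i ^ 2) := by field_simp
      rw [h4]
      gcongr
      linarith
    have h5 : ‖u‖ ^ 2 * dotProduct x (A.mulVec x) ≤ dotProduct u (A.mulVec u) := by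
      have h4 : dotProduct u (A.mulVec u) =
          ‖u‖ ^ 2 * (‖u‖⁻¹ * (‖u‖⁻¹ * dotProduct u (A.mulVec u))) := by field_simp
      rw [h4]
      gcongr
    rw [div_mul_eq_mul_div, div_le_iff₀ (by positivity)]
    nlinarith

/-- Bounds for the inverse `N` of `diag Y + A` that are uniform in `Y ≥ 0`. -/
theorem exists_inv_bounds {A : Matrix ι ι ℝ} (hA : A.PosDef) :
    ∃ Λ L : ℝ, 0 ≤ Λ ∧ 0 ≤ L ∧ ∀ Y : ι → ℝ, (∀ k, 0 ≤ Y k) → ∀ k l,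
      |(Matrix.diagonal Y + A)⁻¹ k l| ≤ Λ ∧ |Y k * (Matrix.diagonal Y + A)⁻¹ k l| ≤ L ∧
      0 ≤ (Matrix.diagonal Y + A)⁻¹ k k ∧ Y k * (Matrix.diagonal Y + A)⁻¹ k k ≤ 1 := by
  obtain ⟨c, hc, hcA⟩ := exists_pos_mul_le_of_posDef hA
  refine ⟨c⁻¹, 1 + ∑ k, ∑ j, |A k j| * c⁻¹, by positivity, by positivity, fun Y hY => ?_⟩
  have hD : (Matrix.diagonal Y + A).PosDef :=
    Matrix.PosDef.posSemidef_add (Matrix.PosSemidef.diagonal hY) hA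
  have hDu := (Matrix.isUnit_iff_isUnit_det _).1 hD.isUnit
  obtain ⟨N, hN⟩ : ∃ N, N = (Matrix.diagonal Y + A)⁻¹ := ⟨_, rfl⟩
  have hDN : (Matrix.diagonal Y + A) * N = 1 := by rw [hN, Matrix.mul_nonsing_inv _ hDu]
  -- the entries of `(diag Y + A) N = 1`, and the quadratic form of the columns of `N`
  have hcol : ∀ k l, Y k * N k l + ∑ j, A k j * N j l = (1 : Matrix ι ι ℝ) k l := by
    intro k l
    rw [← hDN, Matrix.add_mul, Matrix.add_apply, Matrix.diagonal_mul, Matrix.mul_apply]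
  have hquad : ∀ l, ∑ k, Y k * N k l ^ 2 +
      dotProduct (fun k => N k l) (A.mulVec fun k => N k l) = N l l := by
    intro l
    have h : ∑ k, N k l * (Y k * N k l + ∑ j, A k j * N j l) = N l l := by
      simp only [hcol, Matrix.one_apply, mul_ite, mul_one, mul_zero, Finset.sum_ite_eq',
        Finset.mem_univ, if_true]
    rw [← h]
    simp only [mul_add, Finset.sum_add_distrib, dotProduct, Matrix.mulVec]
    congr 1
    exact Finset.sum_congr rfl fun k _ => by ring
  have hYn : ∀ l, 0 ≤ ∑ k, Y k * N k l ^ 2 := fun l =>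
    Finset.sum_nonneg fun k _ => mul_nonneg (hY k) (sq_nonneg _)
  have hsq : ∀ k l, N k l ^ 2 ≤ ∑ j, N j l ^ 2 := fun k l =>
    Finset.single_le_sum (f := fun j => N j l ^ 2) (fun j _ => sq_nonneg _) (Finset.mem_univ k)
  have hsum0 : ∀ l, 0 ≤ ∑ j, N j l ^ 2 := fun l => Finset.sum_nonneg fun j _ => sq_nonneg _
  have hle : ∀ l, c * ∑ j, N j l ^ 2 ≤ N l l := by
    intro l
    have := hcA fun k => N k l
    linarith [hquad l, hYn l]
  have h0 : ∀ l, 0 ≤ N l l := fun l => (mul_nonneg hc.le (hsum0 l)).trans (hle l)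
  have hdiag : ∀ l, N l l ≤ c⁻¹ := by
    intro l
    rw [← one_div, le_div_iff₀ hc]
    have h1 : c * N l l ^ 2 ≤ N l l := (mul_le_mul_of_nonneg_left (hsq l l) hc.le).trans (hle l)
    rcases (h0 l).eq_or_lt with h | h
    · rw [← h]; simp
    · nlinarith
  have hN' : ∀ k l, |N k l| ≤ c⁻¹ := by
    intro k l
    refine abs_le_of_sq_le_sq ?_ (by positivity)
    have h1 : c * N k l ^ 2 ≤ c⁻¹ :=
      (mul_le_mul_of_nonneg_left (hsq k l) hc.le).trans ((hle l).trans (hdiag l))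
    have h2 : N k l ^ 2 = c⁻¹ * (c * N k l ^ 2) := by field_simp
    rw [h2, pow_two c⁻¹]
    gcongr
  rw [← hN]
  refine fun k l => ⟨hN' k l, ?_, h0 k, ?_⟩
  · have h1 : Y k * N k l = (1 : Matrix ι ι ℝ) k l - ∑ j, A k j * N j l := by
      linarith [hcol k l]
    rw [h1]
    refine (abs_sub _ _).trans (add_le_add ?_ ?_)
    · rw [Matrix.one_apply]
      split_ifs <;> simp
    · calc |∑ j, A k j * N j l| ≤ ∑ j, |A k j * N j l| := Finset.abs_sum_le_sum_abs _ _
        _ ≤ ∑ j, |A k j| * c⁻¹ := Finset.sum_le_sum fun j _ => by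
          rw [abs_mul]
          exact mul_le_mul_of_nonneg_left (hN' j l) (abs_nonneg _)
        _ ≤ ∑ k, ∑ j, |A k j| * c⁻¹ :=
          Finset.single_le_sum (f := fun k => ∑ j, |A k j| * c⁻¹)
            (fun i _ => Finset.sum_nonneg fun j _ => by positivity) (Finset.mem_univ k)
  · have h1 : Y k * N k k ^ 2 ≤ N k k := by
      have h2 : Y k * N k k ^ 2 ≤ ∑ j, Y j * N j k ^ 2 :=
        Finset.single_le_sum (f := fun j => Y j * N j k ^ 2)
          (fun j _ => mul_nonneg (hY j) (sq_nonneg _)) (Finset.mem_univ k)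
      have h3 := hcA fun j => N j k
      linarith [hquad k, mul_nonneg hc.le (hsum0 k)]
    rcases (h0 k).eq_or_lt with h | h
    · rw [← h]; simp
    · nlinarith

/-- The contribution of a pair of indices `k ≠ l` to the Ricci form, where at least one of `Y k`,
`Y l` is of order `√s`. -/
theorem pair_bound {Λ L c s yk yl n nk uk ul : ℝ} (hyl : 0 ≤ yl)
    (hs : 0 < s) (hc : 0 ≤ c) (hL : 0 ≤ L) (hΛ : 0 ≤ Λ)
    (hnk0 : 0 ≤ nk) (hnk : nk ≤ Λ) (hynk : |yk * nk| ≤ L)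
    (hynkl : |yk * n| ≤ L) (hynlk : |yl * n| ≤ L) (h : yk ^ 2 ≤ c * s ∨ yl ^ 2 ≤ c * s) :
    -(s * (c * (Λ * L + 2 * L ^ 2)) * (uk ^ 2 + ul ^ 2 + yl * ul ^ 2)) ≤
      -(yk ^ 2 * yl ^ 2 * nk * n * ul ^ 2) - n ^ 2 * yk ^ 2 * yl ^ 2 * uk * ul := by
  have hcs : 0 ≤ c * s := by positivity
  have hyl2 : 0 ≤ yl * ul ^ 2 := by positivity
  have h1 : yk ^ 2 * yl ^ 2 * nk * n * ul ^ 2 ≤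
      c * s * (Λ * L + L ^ 2) * (ul ^ 2 + yl * ul ^ 2) := by
    rcases h with h | h
    · calc yk ^ 2 * yl ^ 2 * nk * n * ul ^ 2 = yk ^ 2 * (nk * ((yl * n) * (yl * ul ^ 2))) := by ring
        _ ≤ yk ^ 2 * (nk * (L * (yl * ul ^ 2))) := by
          gcongr; exact (abs_le.1 hynlk).2
        _ ≤ c * s * (Λ * (L * (yl * ul ^ 2))) := by gcongr
        _ ≤ _ := by
          have : 0 ≤ c * s * (Λ * (L * ul ^ 2)) := by positivity
          have : 0 ≤ c * s * (L ^ 2 * (ul ^ 2 + yl * ul ^ 2)) := by positivity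
          nlinarith
    · calc yk ^ 2 * yl ^ 2 * nk * n * ul ^ 2 ≤ yl ^ 2 * (|yk * nk| * |yk * n| * ul ^ 2) := by
            rw [← abs_mul]
            have := mul_le_mul_of_nonneg_left (le_abs_self (yk * nk * (yk * n)))
              (show 0 ≤ yl ^ 2 * ul ^ 2 by positivity)
            linarith
        _ ≤ c * s * (L * L * ul ^ 2) := by gcongr
        _ ≤ _ := by
          have : 0 ≤ c * s * (L * L * (yl * ul ^ 2)) := by positivity
          have : 0 ≤ c * s * (Λ * L * (ul ^ 2 + yl * ul ^ 2)) := by positivity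
          nlinarith
  have h2 : n ^ 2 * yk ^ 2 * yl ^ 2 * uk * ul ≤ c * s * L ^ 2 * (uk ^ 2 + ul ^ 2) := by
    have h3 : n ^ 2 * yk ^ 2 * yl ^ 2 ≤ c * s * L ^ 2 := by
      rcases h with h | h
      · calc n ^ 2 * yk ^ 2 * yl ^ 2 = yk ^ 2 * |yl * n| ^ 2 := by rw [sq_abs]; ring
          _ ≤ c * s * L ^ 2 := by gcongr
      · calc n ^ 2 * yk ^ 2 * yl ^ 2 = yl ^ 2 * |yk * n| ^ 2 := by rw [sq_abs]; ring
          _ ≤ c * s * L ^ 2 := by gcongr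
    have h4 : 0 ≤ n ^ 2 * yk ^ 2 * yl ^ 2 := by positivity
    calc n ^ 2 * yk ^ 2 * yl ^ 2 * uk * ul ≤ n ^ 2 * yk ^ 2 * yl ^ 2 * (uk ^ 2 + ul ^ 2) := by
          nlinarith [sq_nonneg (uk - ul), sq_nonneg uk, sq_nonneg ul]
      _ ≤ _ := by gcongr
  have h5 : 0 ≤ c * s * (Λ * L) * uk ^ 2 := by positivity
  have h6 : 0 ≤ c * s * L ^ 2 * (uk ^ 2 + yl * ul ^ 2) := by positivity
  nlinarith

/-- The Ricci form is bounded below by the metric, uniformly in `s`, as long as no two of the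
`Y k` exceed order `√s`. -/
theorem exists_le_ricciForm {A : Matrix ι ι ℝ} (hA : A.PosDef) {c : ℝ} (hc : 0 ≤ c) :
    ∃ κ : ℝ, ∀ s : ℝ, 0 < s → ∀ Y : ι → ℝ, (∀ k, 0 ≤ Y k) →
      (∀ k l, k ≠ l → Y k ^ 2 ≤ c * s ∨ Y l ^ 2 ≤ c * s) → ∀ u : ι → ℝ,
      κ * dotProduct u ((s⁻¹ • (Matrix.diagonal Y + A)).mulVec u) ≤
        ricciForm (s⁻¹ • (Matrix.diagonal Y + A))⁻¹ (fun k => 2 * Y k ^ 2 / s ^ 2)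
          (fun k => -(8 * Y k ^ 3 / s ^ 3)) u := by
  obtain ⟨Λ, L, hΛ, hL, hbd⟩ := exists_inv_bounds hA
  obtain ⟨μ, hμ, hμA⟩ := exists_pos_mul_le_of_posDef hA
  obtain ⟨M, hM⟩ : ∃ M, M = c * (Λ * L + 2 * L ^ 2) := ⟨_, rfl⟩
  have hM0 : 0 ≤ M := by rw [hM]; positivity
  refine ⟨-(2 * (M * (Fintype.card ι * (2 * μ⁻¹ + 1)))), fun s hs Y hY hpair u => ?_⟩
  have hDu : IsUnit (Matrix.diagonal Y + A).det := (Matrix.isUnit_iff_isUnit_det _).1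
    (Matrix.PosDef.posSemidef_add (Matrix.PosSemidef.diagonal hY) hA).isUnit
  have hsymm : ((Matrix.diagonal Y + A)⁻¹).transpose = (Matrix.diagonal Y + A)⁻¹ := by
    have := (Matrix.PosDef.posSemidef_add (Matrix.PosSemidef.diagonal hY) hA).inv.isHermitian
    rwa [Matrix.IsHermitian, Matrix.conjTranspose_eq_transpose_of_trivial] at this
  have hbd := hbd Y hY
  have hinv : (s⁻¹ • (Matrix.diagonal Y + A))⁻¹ = s • (Matrix.diagonal Y + A)⁻¹ := by
    refine Matrix.inv_eq_right_inv ?_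
    rw [Matrix.smul_mul, Matrix.mul_smul, smul_smul, inv_mul_cancel₀ hs.ne', one_smul,
      Matrix.mul_nonsing_inv _ hDu]
  have hquad : dotProduct u ((s⁻¹ • (Matrix.diagonal Y + A)).mulVec u) =
      s⁻¹ * (∑ k, Y k * u k ^ 2 + dotProduct u (A.mulVec u)) := by
    rw [Matrix.smul_mulVec, dotProduct_smul, smul_eq_mul, Matrix.add_mulVec, dotProduct_add]
    congr 2
    simp only [dotProduct, Matrix.mulVec_diagonal]
    exact Finset.sum_congr rfl fun k _ => by ring
  rw [hquad, hinv]
  obtain ⟨N, hN⟩ : ∃ N, N = (Matrix.diagonal Y + A)⁻¹ := ⟨_, rfl⟩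
  rw [← hN] at hbd hsymm ⊢
  have hNs : ∀ k l, N k l = N l k := fun k l => congrFun (congrFun hsymm.symm k) l
  obtain ⟨T, hT⟩ : ∃ T : ι → ι → ℝ, ∀ k l, T k l = -(Y k ^ 2 * Y l ^ 2 * N k k * N k l * u l ^ 2) -
    N k l ^ 2 * Y k ^ 2 * Y l ^ 2 * u k * u l +
      if l = k then 2 * (N k k * Y k ^ 3 * u k ^ 2) else 0 := ⟨_, fun _ _ => rfl⟩
  have hform : ricciForm (s • N) (fun k => 2 * Y k ^ 2 / s ^ 2)
      (fun k => -(8 * Y k ^ 3 / s ^ 3)) u = 2 / s ^ 2 * ∑ k, ∑ l, T k l := by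
    simp only [ricciForm, hT, Finset.sum_add_distrib, Finset.sum_sub_distrib, Finset.sum_ite_eq',
      Finset.mem_univ, if_true, Matrix.smul_apply, smul_eq_mul, mul_add, mul_sub, Finset.mul_sum]
    have e1 : ∀ k l, -(1 / 2) * (2 * Y k ^ 2 / s ^ 2 * (2 * Y l ^ 2 / s ^ 2) * (s * N k k) *
        (s * N k l) * u l ^ 2) =
        2 / s ^ 2 * -(Y k ^ 2 * Y l ^ 2 * N k k * N k l * u l ^ 2) := by
      intro k l; field_simp
    have e2 : ∀ k, -(1 / 2) * (s * N k k * -(8 * Y k ^ 3 / s ^ 3) * u k ^ 2) =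
        2 / s ^ 2 * (2 * (N k k * Y k ^ 3 * u k ^ 2)) := by
      intro k; field_simp; ring
    have e3 : ∀ k l, -(1 / 2) * ((s * N k l) ^ 2 * (2 * Y k ^ 2 / s ^ 2) * (2 * Y l ^ 2 / s ^ 2) *
        u k * u l) = -(2 / s ^ 2 * (N k l ^ 2 * Y k ^ 2 * Y l ^ 2 * u k * u l)) := by
      intro k l; field_simp
    simp only [e1, e2, e3, Finset.sum_neg_distrib]
    ring
  have hTl : ∀ k l, -(s * M * (u k ^ 2 + u l ^ 2 + Y l * u l ^ 2)) ≤ T k l := by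
    intro k l
    rw [hT]
    have hYl := hY l
    by_cases hkl : l = k
    · subst hkl
      obtain ⟨-, -, h1, h2⟩ := hbd l l
      have h3 : 0 ≤ 2 * (N l l * Y l ^ 3 * u l ^ 2 * (1 - Y l * N l l)) := by
        have : 0 ≤ 1 - Y l * N l l := by linarith
        positivity
      have h4 : 0 ≤ s * M * (u l ^ 2 + u l ^ 2 + Y l * u l ^ 2) := by positivity
      rw [if_pos rfl]
      nlinarith
    · rw [if_neg hkl, add_zero, hM]
      refine pair_bound hYl hs hc hL hΛ (hbd k k).2.2.1 ((le_abs_self _).trans (hbd k k).1)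
        (hbd k k).2.1 (hbd k l).2.1 ?_ (hpair k l (Ne.symm hkl))
      rw [hNs]
      exact (hbd l k).2.1
  have hsum : -(s * M * (Fintype.card ι * (2 * ∑ k, u k ^ 2 + ∑ k, Y k * u k ^ 2))) ≤
      ∑ k, ∑ l, T k l := by
    refine le_trans (le_of_eq ?_)
      (Finset.sum_le_sum fun k _ => Finset.sum_le_sum fun l _ => hTl k l)
    simp only [Finset.sum_neg_distrib, ← Finset.mul_sum, Finset.sum_add_distrib, Finset.sum_const,
      Finset.card_univ, nsmul_eq_mul]
    ring
  have hYu : 0 ≤ ∑ k, Y k * u k ^ 2 := Finset.sum_nonneg fun k _ => mul_nonneg (hY k) (sq_nonneg _)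
  have hu := hμA u
  have hu' : ∑ k, u k ^ 2 ≤ μ⁻¹ * dotProduct u (A.mulVec u) := by
    rw [inv_mul_eq_div, le_div_iff₀ hμ, mul_comm]
    exact hu
  have hu0 : 0 ≤ dotProduct u (A.mulVec u) := by
    simpa using hA.posSemidef.dotProduct_mulVec_nonneg u
  have hμ' : 0 < μ⁻¹ := inv_pos.2 hμ
  have hfin : 2 * ∑ k, u k ^ 2 + ∑ k, Y k * u k ^ 2 ≤
      (2 * μ⁻¹ + 1) * (∑ k, Y k * u k ^ 2 + dotProduct u (A.mulVec u)) := by nlinarith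
  rw [hform]
  calc -(2 * (M * (Fintype.card ι * (2 * μ⁻¹ + 1)))) *
        (s⁻¹ * (∑ k, Y k * u k ^ 2 + dotProduct u (A.mulVec u))) =
      2 / s ^ 2 * -(s * M * (Fintype.card ι * ((2 * μ⁻¹ + 1) *
        (∑ k, Y k * u k ^ 2 + dotProduct u (A.mulVec u))))) := by field_simp
    _ ≤ 2 / s ^ 2 * -(s * M * (Fintype.card ι * (2 * ∑ k, u k ^ 2 + ∑ k, Y k * u k ^ 2))) := by
      gcongr
    _ ≤ _ := by gcongr

end Estimate

/-! ### Positivity of the model metric -/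

section Model

variable {m k : ℕ} {A : Matrix (Fin m ⊕ Fin k) (Fin m ⊕ Fin k) ℝ} {s : ℝ}

theorem two_moment_eq (p : Space m k) (j : Fin m) :
    2 * moment p (Sum.inl j) = (p.1 j).re ^ 2 + (p.1 j).im ^ 2 := by
  simp only [moment, Sum.elim_inl, ← Complex.normSq_eq_norm_sq, Complex.normSq_apply]
  ring

theorem moment_inl_nonneg (p : Space m k) (j : Fin m) : 0 ≤ moment p (Sum.inl j) := by
  simp only [moment, Sum.elim_inl]
  positivity

/-- The symplectic reduction behind the closed form of the metric: with `z = Q η` it is a sum of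
three nonnegative terms, the first of which is `∑ |dζⱼ - i zⱼ ζⱼ|²`. -/
theorem metric_apply_self_eq (hA : A.PosDef) (hs : 0 < s) (p : Space m k) (v : Cover m k) :
    ∃ z : Fin m → ℝ, metric A s p v v =
      ∑ j, (((v.1 j).re + z j * (p.1 j).im) ^ 2 + ((v.1 j).im - z j * (p.1 j).re) ^ 2) +
      dotProduct (fun i => dx p i v) ((s⁻¹ • A).mulVec fun i => dx p i v) +
      dotProduct (Sum.elim z v.2.2) ((s • A⁻¹).mulVec (Sum.elim z v.2.2)) := by
  have hPt : (s • A⁻¹).transpose = s • A⁻¹ := by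
    have := (hA.inv.smul hs).isHermitian
    rwa [Matrix.IsHermitian, Matrix.conjTranspose_eq_transpose_of_trivial] at this
  obtain ⟨P, hP⟩ : ∃ P, P = s • A⁻¹ := ⟨_, rfl⟩
  have hR := posDef_inner hA hs (d := fun j => 2 * moment p (Sum.inl j))
    fun j => mul_nonneg zero_le_two (moment_inl_nonneg p j)
  rw [← hP] at hPt hR
  have hRu := (Matrix.isUnit_iff_isUnit_det _).1 hR.isUnit
  obtain ⟨R, hRdef⟩ : ∃ R, R = Matrix.diagonal (fun j => 2 * moment p (Sum.inl j)) +
    P.toBlocks₁₁ := ⟨_, rfl⟩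
  obtain ⟨η, hη⟩ : ∃ η : Fin m → ℝ, η = (fun j => angular p j v) -
    P.toBlocks₁₂.mulVec v.2.2 := ⟨_, rfl⟩
  have hη' : (fun j => (angular p j - ∑ l, P.toBlocks₁₂ j l • dTorus l : Cover m k →L[ℝ] ℝ) v) =
      η := by
    rw [hη]
    ext j
    simp only [_root_.sub_apply, _root_.sum_apply, _root_.smul_apply, smul_eq_mul, Pi.sub_apply,
      Matrix.mulVec, dotProduct]
    rfl
  refine ⟨R⁻¹.mulVec η, ?_⟩
  obtain ⟨z, hz⟩ : ∃ z, z = R⁻¹.mulVec η := ⟨_, rfl⟩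
  have hRz : R.mulVec z = η := by
    rw [hz, Matrix.mulVec_mulVec, Matrix.mul_nonsing_inv _ (hRdef ▸ hRu), Matrix.one_mulVec]
  -- completing the square: `ηᵗ R⁻¹ η = 2 zᵗ η - zᵗ R z`
  have hsq : dotProduct η z = 2 * dotProduct z η - dotProduct z (R.mulVec z) := by
    rw [hRz, dotProduct_comm]; ring
  have hblock : dotProduct (Sum.elim z v.2.2) (P.mulVec (Sum.elim z v.2.2)) =
      dotProduct z (P.toBlocks₁₁.mulVec z) + 2 * dotProduct z (P.toBlocks₁₂.mulVec v.2.2) +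
      dotProduct v.2.2 (P.toBlocks₂₂.mulVec v.2.2) := by
    have h21 : P.toBlocks₂₁ = P.toBlocks₁₂.transpose := by
      ext i j
      exact congrFun (congrFun hPt.symm (Sum.inr i)) (Sum.inl j)
    conv_lhs => rw [← P.fromBlocks_toBlocks]
    rw [Matrix.fromBlocks_mulVec, sumElim_dotProduct_sumElim, Sum.elim_comp_inl, Sum.elim_comp_inr,
      dotProduct_add, dotProduct_add, h21, Matrix.mulVec_transpose, dotProduct_comm v.2.2,
      ← Matrix.dotProduct_mulVec]
    ring
  have hRz' : dotProduct z (R.mulVec z) = ∑ j, 2 * moment p (Sum.inl j) * z j ^ 2 +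
      dotProduct z (P.toBlocks₁₁.mulVec z) := by
    rw [hRdef, Matrix.add_mulVec, dotProduct_add]
    congr 1
    simp only [dotProduct, Matrix.mulVec_diagonal]
    exact Finset.sum_congr rfl fun j _ => by ring
  have hzη : dotProduct z η = ∑ j, z j * angular p j v -
      dotProduct z (P.toBlocks₁₂.mulVec v.2.2) := by
    rw [hη, dotProduct_sub]; rfl
  rw [metric, ← hP, ← hRdef, ← hz]
  simp only [_root_.add_apply, _root_.sub_apply, tensorForm_apply]
  simp only [_root_.sub_apply] at hη'
  rw [hη', ← hz, hsq, hzη, hRz', hblock, Matrix.one_mulVec, Matrix.one_mulVec]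
  have e1 : dotProduct (fun j => dRe j v) (fun j => dRe j v) +
      dotProduct (fun j => dIm j v) (fun j => dIm j v) - 2 * ∑ j, z j * angular p j v +
      ∑ j, 2 * moment p (Sum.inl j) * z j ^ 2 =
      ∑ j, (((v.1 j).re + z j * (p.1 j).im) ^ 2 + ((v.1 j).im - z j * (p.1 j).re) ^ 2) := by
    simp only [dotProduct, Finset.mul_sum, ← Finset.sum_add_distrib, ← Finset.sum_sub_distrib]
    refine Finset.sum_congr rfl fun j _ => ?_
    rw [two_moment_eq]
    simp only [angular, _root_.sub_apply, _root_.smul_apply, smul_eq_mul]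
    have h1 : dRe j v = (v.1 j).re := rfl
    have h2 : dIm j v = (v.1 j).im := rfl
    rw [h1, h2]
    ring
  rw [← e1]
  have h3 : (fun l => dTorus l v) = v.2.2 := rfl
  rw [h3]
  ring

/-- The model metric is positive definite, also where some `ζⱼ` vanish. -/
theorem metric_pos (hA : A.PosDef) (hs : 0 < s) (p : Space m k) {v : Cover m k} (hv : v ≠ 0) :
    0 < metric A s p v v := by
  obtain ⟨z, hz⟩ := metric_apply_self_eq hA hs p v
  rw [hz]
  have h1 : 0 ≤ ∑ j, (((v.1 j).re + z j * (p.1 j).im) ^ 2 +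
      ((v.1 j).im - z j * (p.1 j).re) ^ 2) := Finset.sum_nonneg fun j _ => by positivity
  have hG := hA.smul (inv_pos.2 hs)
  have hP := hA.inv.smul hs
  have h2 : 0 ≤ dotProduct (fun i => dx p i v) ((s⁻¹ • A).mulVec fun i => dx p i v) := by
    simpa only [star_trivial] using hG.posSemidef.dotProduct_mulVec_nonneg (fun i => dx p i v)
  have h3 : 0 ≤ dotProduct (Sum.elim z v.2.2) ((s • A⁻¹).mulVec (Sum.elim z v.2.2)) := by
    simpa only [star_trivial] using hP.posSemidef.dotProduct_mulVec_nonneg (Sum.elim z v.2.2)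
  by_cases hzb : Sum.elim z v.2.2 = 0
  · by_cases hd : (fun i => dx p i v) = 0
    · have hz0 : ∀ j, z j = 0 := fun j => congrFun hzb (Sum.inl j)
      have hb0 : v.2.2 = 0 := funext fun l => congrFun hzb (Sum.inr l)
      have hx0 : v.2.1 = 0 := funext fun l => congrFun hd (Sum.inr l)
      have hv1 : v.1 ≠ 0 := fun h => hv (Prod.ext h (Prod.ext hx0 hb0))
      obtain ⟨j, hj⟩ := Function.ne_iff.1 hv1
      have h4 : 0 < ∑ j, (((v.1 j).re + z j * (p.1 j).im) ^ 2 +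
          ((v.1 j).im - z j * (p.1 j).re) ^ 2) := by
        refine Finset.sum_pos' (fun j _ => by positivity) ⟨j, Finset.mem_univ j, ?_⟩
        rw [hz0]
        have := Complex.normSq_pos.2 hj
        rw [Complex.normSq_apply] at this
        simp only [zero_mul, add_zero, sub_zero]
        linarith
      linarith
    · have := hG.dotProduct_mulVec_pos hd
      rw [star_trivial] at this
      linarith
  · have := hP.dotProduct_mulVec_pos hzb
    rw [star_trivial] at this
    linarith

theorem coverMetric_isInvertible (hA : A.PosDef) (hs : 0 < s) (q : Cover m k) :
    (coverMetric A s q).IsInvertible :=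
  isInvertible_of_pos fun _ hv => metric_pos hA hs (proj q) hv

/-! ### The distance to the codimension two faces -/

theorem curveLength_le {E : Type*} [NormedAddCommGroup E] [NormedSpace ℝ E]
    {g : E → E →L[ℝ] E →L[ℝ] ℝ} {γ : ℝ → E} {C : ℝ}
    (h : ∀ t ∈ Set.Icc (0 : ℝ) 1, g (γ t) (deriv γ t) (deriv γ t) ≤ C) :
    curveLength g γ ≤ ENNReal.ofReal √C := by
  refine (MeasureTheory.setLIntegral_mono measurable_const fun t ht =>
    ENNReal.ofReal_le_ofReal (Real.sqrt_le_sqrt (h t ht))).trans ?_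
  simp

/-- Shrinking the small coordinates `ζᵢ` and `ζⱼ` radially to `0` gives a curve to the codimension
two faces. As the angular forms vanish along it, its squared speed is `∑ |dζ|² + s⁻¹ ᵗdx A dx`,
which is of order `ε √s + s⁻¹ (ε √s)²` when `xᵢ, xⱼ ≤ ε √s`. -/
theorem exists_sqrt_lt_moment (A : Matrix (Fin m ⊕ Fin k) (Fin m ⊕ Fin k) ℝ) {r : ℝ} (hr : 0 < r) :
    ∃ ε > 0, ∀ s : ℝ, 0 < s → s < 1 → ∀ q : Cover m k,
      proj q ∉ nbhd A s (codimTwo m k) r → ∀ i j : Fin m, i ≠ j →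
        ε * √s < moment (proj q) (Sum.inl i) ∨ ε * √s < moment (proj q) (Sum.inl j) := by
  obtain ⟨S, hS⟩ : ∃ S, S = ∑ i, ∑ j, |A i j| := ⟨_, rfl⟩
  have hS0 : 0 ≤ S := by rw [hS]; positivity
  have hC : 0 < 2 * (m : ℝ) + 4 * S + 1 := by positivity
  refine ⟨min 1 (r ^ 2 / (2 * m + 4 * S + 1)), by positivity, fun s hs hs1 q hq i j hij => ?_⟩
  obtain ⟨ε, hε⟩ : ∃ ε, ε = min 1 (r ^ 2 / (2 * m + 4 * S + 1)) := ⟨_, rfl⟩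
  rw [← hε]
  have hε0 : 0 < ε := by rw [hε]; positivity
  have hε1 : ε ≤ 1 := hε ▸ min_le_left _ _
  have hεr : ε * (2 * m + 4 * S + 1) ≤ r ^ 2 := by
    rw [← le_div_iff₀ hC, hε]
    exact min_le_right _ _
  have hsq1 : √s ≤ 1 := Real.sqrt_le_one.2 hs1.le
  by_contra! hcon
  apply hq
  classical
  obtain ⟨w, hw⟩ : ∃ w : Cover m k, w = ((fun l => if l = i ∨ l = j then q.1 l else 0), 0) :=
    ⟨_, rfl⟩
  have hw1 : ∀ l, w.1 l = if l = i ∨ l = j then q.1 l else 0 := fun l => by rw [hw]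
  have hw2 : w.2 = 0 := by rw [hw]
  have hder : ∀ t, deriv (fun t : ℝ => (q - w) + t • w) t = w := by
    intro t
    have h := ((hasDerivAt_id t).smul_const w).const_add (q - w)
    simpa using h.deriv
  have hmom : ∀ l, l = i ∨ l = j → ‖q.1 l‖ ^ 2 ≤ 2 * (ε * √s) := by
    rintro l (rfl | rfl)
    · have := hcon.1
      simp only [moment, Sum.elim_inl, proj] at this
      linarith
    · have := hcon.2
      simp only [moment, Sum.elim_inl, proj] at this
      linarith
  have hwn : ∀ l, (w.1 l).re ^ 2 + (w.1 l).im ^ 2 ≤ 2 * (ε * √s) := by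
    intro l
    rw [hw1]
    split_ifs with h
    · refine le_trans (le_of_eq ?_) (hmom l h)
      rw [← Complex.normSq_eq_norm_sq, Complex.normSq_apply]; ring
    · simp; positivity
  have hspeed : ∀ t ∈ Set.Icc (0 : ℝ) 1,
      coverMetric A s ((q - w) + t • w) w w ≤ ε * (2 * m + 4 * S) := by
    intro t ht
    obtain ⟨y, hy⟩ : ∃ y, y = proj ((q - w) + t • w) := ⟨_, rfl⟩
    have hy1 : ∀ l, w.1 l = 0 ∨ y.1 l = t • w.1 l := by
      intro l
      by_cases h : l = i ∨ l = j
      · right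
        have : y.1 l = (q.1 l - w.1 l) + t • w.1 l := by rw [hy]; rfl
        rw [this, hw1, if_pos h, sub_self, zero_add]
      · left
        rw [hw1, if_neg h]
    have hang : ∀ l, angular y l w = 0 := by
      intro l
      have : angular y l w = (y.1 l).re * (w.1 l).im - (y.1 l).im * (w.1 l).re := rfl
      rw [this]
      rcases hy1 l with h | h <;> rw [h] <;> simp
      ring
    have htor : ∀ l, dTorus l w = 0 := by
      intro l
      have : dTorus l w = w.2.2 l := rfl
      rw [this, hw2]; rfl
    have hdx : ∀ l, |dx y l w| ≤ 2 * (ε * √s) := by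
      rintro (l | l)
      · have h1 : dx y (Sum.inl l) w = (y.1 l).re * (w.1 l).re + (y.1 l).im * (w.1 l).im := rfl
        rw [h1]
        rcases hy1 l with h | h
        · rw [h]; simp; positivity
        · rw [h, Complex.real_smul]
          have h2 : (↑t * w.1 l).re * (w.1 l).re + (↑t * w.1 l).im * (w.1 l).im =
              t * ((w.1 l).re ^ 2 + (w.1 l).im ^ 2) := by simp; ring
          rw [h2, abs_of_nonneg (mul_nonneg ht.1 (by positivity))]
          calc t * ((w.1 l).re ^ 2 + (w.1 l).im ^ 2) ≤ 1 * (2 * (ε * √s)) := by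
                gcongr
                · exact ht.2
                · exact hwn l
            _ = _ := one_mul _
      · have h1 : dx y (Sum.inr l) w = w.2.1 l := rfl
        rw [h1, hw2]
        simp; positivity
    rw [coverMetric, ← hy, metric]
    simp only [_root_.add_apply, _root_.sub_apply, tensorForm_apply, hang, htor, _root_.sum_apply,
      _root_.smul_apply, smul_zero, Finset.sum_const_zero, sub_zero]
    have hz : ∀ (n : ℕ), (fun _ : Fin n => (0 : ℝ)) = 0 := fun n => rfl
    rw [hz, hz, zero_dotProduct, zero_dotProduct, Matrix.one_mulVec, Matrix.one_mulVec, add_zero,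
      sub_zero, Matrix.smul_mulVec, dotProduct_smul, smul_eq_mul]
    have e1 : dotProduct (fun j => dRe j w) (fun j => dRe j w) +
        dotProduct (fun j => dIm j w) (fun j => dIm j w) ≤ m * (2 * ε) := by
      simp only [dotProduct, ← Finset.sum_add_distrib]
      have h1 : ∀ l : Fin m, dRe l w * dRe l w + dIm l w * dIm l w ≤ 2 * ε := by
        intro l
        have h2 : dRe l w = (w.1 l).re := rfl
        have h3 : dIm l w = (w.1 l).im := rfl
        rw [h2, h3]
        have := hwn l
        nlinarith
      refine (Finset.sum_le_sum fun l _ => h1 l).trans ?_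
      simp
    have e2 : s⁻¹ * dotProduct (fun i => dx y i w) (A.mulVec fun i => dx y i w) ≤
        4 * ε * S := by
      have h1 : dotProduct (fun i => dx y i w) (A.mulVec fun i => dx y i w) ≤
          (2 * (ε * √s)) ^ 2 * S := by
        rw [hS]
        simp only [dotProduct, Matrix.mulVec, Finset.mul_sum]
        refine Finset.sum_le_sum fun a _ => Finset.sum_le_sum fun b _ => ?_
        calc dx y a w * (A a b * dx y b w) ≤ |dx y a w * (A a b * dx y b w)| := le_abs_self _
          _ = |dx y a w| * |dx y b w| * |A a b| := by rw [abs_mul, abs_mul]; ring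
          _ ≤ (2 * (ε * √s)) * (2 * (ε * √s)) * |A a b| := by
            gcongr
            · exact hdx a
            · exact hdx b
          _ = _ := by ring
      calc s⁻¹ * dotProduct (fun i => dx y i w) (A.mulVec fun i => dx y i w) ≤
            s⁻¹ * ((2 * (ε * √s)) ^ 2 * S) := by gcongr
        _ = 4 * (ε * ε) * S := by
          have h2 : √s ^ 2 = s := Real.sq_sqrt hs.le
          rw [mul_pow, mul_pow, h2]
          field_simp
          ring
        _ ≤ 4 * (ε * 1) * S := by gcongr
        _ = _ := by ring
    linarith
  have hlen : curveLength (coverMetric A s) (fun t : ℝ => (q - w) + t • w) ≤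
      ENNReal.ofReal √(ε * (2 * m + 4 * S)) := by
    refine curveLength_le fun t ht => ?_
    rw [hder]
    exact hspeed t ht
  have hmem : proj (q - w) ∈ codimTwo m k := by
    refine ⟨i, j, hij, ?_, ?_⟩
    · have : (proj (q - w)).1 i = q.1 i - w.1 i := rfl
      simp [moment, this, hw1]
    · have : (proj (q - w)).1 j = q.1 j - w.1 j := rfl
      simp [moment, this, hw1]
  have hdist : riemDist A s (proj (q - w)) (proj q) ≤
      curveLength (coverMetric A s) (fun t : ℝ => (q - w) + t • w) := by
    refine iInf_le_of_le (fun t : ℝ => (q - w) + t • w) (iInf_le_of_le ?_ (iInf_le_of_le ?_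
      (iInf_le _ ?_)))
    · exact (contDiff_const.add (contDiff_id.smul contDiff_const)).contDiffOn
    · simp
    · simp
  have hinf : (⨅ h ∈ codimTwo m k, riemDist A s h (proj q)) ≤
      ENNReal.ofReal √(ε * (2 * m + 4 * S)) := iInf₂_le_of_le _ hmem (hdist.trans hlen)
  refine lt_of_le_of_lt hinf ?_
  rw [ENNReal.ofReal_lt_ofReal_iff hr, Real.sqrt_lt' hr]
  nlinarith

end Model

/-! ### Action-angle coordinates on the model space -/

section Chart

variable {m k : ℕ} {A : Matrix (Fin m ⊕ Fin k) (Fin m ⊕ Fin k) ℝ} {s : ℝ}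

/-- The diagonal part `1 / (2 xⱼ)` of the Hessian `G_s`. -/
def potential₂ : Fin m ⊕ Fin k → ℝ → ℝ := Sum.elim (fun _ x => 1 / (2 * x)) fun _ _ => 0

/-- Minus the first derivative of `potential₂`. -/
def potential₃ : Fin m ⊕ Fin k → ℝ → ℝ := Sum.elim (fun _ x => 1 / (2 * x ^ 2)) fun _ _ => 0

/-- Minus the second derivative of `potential₂`. -/
def potential₄ : Fin m ⊕ Fin k → ℝ → ℝ := Sum.elim (fun _ x => -(1 / x ^ 3)) fun _ _ => 0

/-- The interior of the moment polyhedron. -/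
def interiorPolyhedron (m k : ℕ) : Set (Fin m ⊕ Fin k → ℝ) := {x | ∀ j : Fin m, 0 < x (Sum.inl j)}

theorem smul_diagonal_add_eq_hess (hs : 0 < s) (x : Fin m ⊕ Fin k → ℝ) :
    s⁻¹ • (Matrix.diagonal (Sum.elim (fun j => s / (2 * x (Sum.inl j))) 0) + A) =
      hess potential₂ (s⁻¹ • A) x := by
  rw [hess, smul_add, ← Matrix.diagonal_smul]
  congr 2
  funext i
  rcases i with j | l
  · simp [potential₂]
    field_simp
  · simp [potential₂]

theorem isHessianOn_model (hA : A.PosDef) (hs : 0 < s) :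
    IsHessianOn potential₂ potential₃ potential₄ (s⁻¹ • A) (interiorPolyhedron m k) where
  isOpen := by
    simp only [interiorPolyhedron, Set.ofPred_forall]
    exact isOpen_iInter_of_finite fun j => isOpen_lt continuous_const (continuous_apply _)
  smooth := by
    rintro x hx (j | l)
    · exact contDiffAt_const.div (contDiffAt_const.mul contDiffAt_id)
        (mul_ne_zero two_ne_zero (hx j).ne')
    · exact contDiffAt_const
  deriv := by
    rintro x hx (j | l)
    · have h0 := (hx j).ne'
      have h := ((hasDerivAt_id (x (Sum.inl j))).const_mul (2 : ℝ)).inv (mul_ne_zero two_ne_zero h0)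
      simp only [potential₂, potential₃, Sum.elim_inl, one_div]
      refine h.congr_deriv ?_
      simp only [id]
      field_simp
    · simpa [potential₂, potential₃] using hasDerivAt_const (x (Sum.inr l)) (0 : ℝ)
  deriv₂ := by
    rintro x hx (j | l)
    · have h0 := (hx j).ne'
      have h := ((hasDerivAt_pow 2 (x (Sum.inl j))).const_mul (2 : ℝ)).inv
        (mul_ne_zero two_ne_zero (pow_ne_zero 2 h0))
      simp only [potential₃, potential₄, Sum.elim_inl, one_div]
      refine h.congr_deriv ?_
      field_simp
      ring
    · simpa [potential₃, potential₄] using hasDerivAt_const (x (Sum.inr l)) (0 : ℝ)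
  posDef := by
    intro x hx
    refine Matrix.PosDef.posSemidef_add (Matrix.PosSemidef.diagonal ?_) (hA.smul (inv_pos.2 hs))
    rintro (j | l)
    · have := hx j
      simp only [potential₂, Sum.elim_inl, Pi.zero_apply]
      positivity
    · simp [potential₂]

/-- Action-angle coordinates near a point `q₀` with all `ζⱼ ≠ 0`: the moment map and the angles,
where the angle of `ζⱼ` is measured from that of `q₀`. -/
def actionAngle (q₀ q : Cover m k) : (Fin m ⊕ Fin k → ℝ) × (Fin m ⊕ Fin k → ℝ) :=
  (moment (proj q), Sum.elim (fun j => (Complex.log (q.1 j / q₀.1 j)).im) q.2.2)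

/-- The domain on which `actionAngle q₀` is smooth. -/
def actionAngleDomain (q₀ : Cover m k) : Set (Cover m k) :=
  {q | ∀ j, q.1 j / q₀.1 j ∈ Complex.slitPlane}

theorem ne_zero_of_mem_domain {q₀ q : Cover m k} (hq : q ∈ actionAngleDomain q₀) (j : Fin m) :
    q.1 j ≠ 0 := by
  intro h
  have := Complex.slitPlane_ne_zero (hq j)
  rw [h, zero_div] at this
  exact this rfl

theorem ne_zero_base_of_mem_domain {q₀ q : Cover m k} (hq : q ∈ actionAngleDomain q₀) (j : Fin m) :
    q₀.1 j ≠ 0 := by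
  intro h
  have := Complex.slitPlane_ne_zero (hq j)
  rw [h, div_zero] at this
  exact this rfl

theorem self_mem_domain {q₀ : Cover m k} (h : ∀ j, q₀.1 j ≠ 0) : q₀ ∈ actionAngleDomain q₀ := by
  intro j
  rw [div_self (h j)]
  exact Complex.one_mem_slitPlane

theorem isOpen_actionAngleDomain (q₀ : Cover m k) : IsOpen (actionAngleDomain q₀) := by
  simp only [actionAngleDomain, Set.ofPred_forall]
  refine isOpen_iInter_of_finite fun j => Complex.isOpen_slitPlane.preimage ?_
  fun_prop

/-- The coordinate `ζⱼ`. -/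
def complexCoord (m k : ℕ) (j : Fin m) : Cover m k →L[ℝ] ℂ :=
  (ContinuousLinearMap.proj j).comp (ContinuousLinearMap.fst ℝ _ _)

theorem contDiffAt_actionAngle {q₀ q : Cover m k} (hq : q ∈ actionAngleDomain q₀) :
    ContDiffAt ℝ ∞ (actionAngle q₀) q := by
  refine ContDiffAt.prodMk (contDiffAt_pi.2 ?_) (contDiffAt_pi.2 ?_)
  · rintro (j | l)
    · have h : ContDiff ℝ ∞ fun q : Cover m k => ((q.1 j).re ^ 2 + (q.1 j).im ^ 2) / 2 :=
        ((((dRe j).contDiff.pow 2)).add ((dIm j).contDiff.pow 2)).div_const 2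
      have h' : (fun q : Cover m k => moment (proj q) (Sum.inl j)) =
          fun q => ((q.1 j).re ^ 2 + (q.1 j).im ^ 2) / 2 := by
        funext q
        have := two_moment_eq (proj q) j
        rw [eq_div_iff two_ne_zero, mul_comm]
        exact this
      exact (h' ▸ h).contDiffAt
    · exact (dx (proj q) (Sum.inr l)).contDiff.contDiffAt
  · rintro (j | l)
    · have h1 : ContDiffAt ℝ ∞ Complex.log (q.1 j / q₀.1 j) :=
        (Complex.contDiffAt_log (n := ∞) (hq j)).restrict_scalars ℝ
      have h2 : ContDiffAt ℝ ∞ (fun q : Cover m k => q.1 j / q₀.1 j) q :=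
        (complexCoord m k j).contDiff.contDiffAt.div_const _
      exact Complex.imCLM.contDiff.contDiffAt.comp q (h1.comp q h2)
    · exact (dTorus l).contDiff.contDiffAt

theorem hasFDerivAt_actionAngle {q₀ q : Cover m k} (hq : q ∈ actionAngleDomain q₀) :
    HasFDerivAt (actionAngle q₀) ((ContinuousLinearMap.pi (dx (proj q))).prod
      (ContinuousLinearMap.pi (dθ (proj q)))) q := by
  refine HasFDerivAt.prodMk (hasFDerivAt_pi.2 ?_) (hasFDerivAt_pi.2 ?_)
  · rintro (j | l)
    · have h1 := (((dRe (k := k) j).hasFDerivAt (x := q)).pow 2).add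
        (((dIm (k := k) j).hasFDerivAt (x := q)).pow 2)
      have h2 := h1.const_mul (1 / 2 : ℝ)
      have h3 : (fun q : Cover m k => moment (proj q) (Sum.inl j)) = fun q =>
          (1 / 2 : ℝ) * ((dRe j q) ^ 2 + (dIm j q) ^ 2) := by
        funext q
        have h4 := two_moment_eq (proj q) j
        have h5 : dRe j q = ((proj q).1 j).re := rfl
        have h6 : dIm j q = ((proj q).1 j).im := rfl
        rw [h5, h6]
        linarith
      rw [h3]
      refine h2.congr_fderiv (ContinuousLinearMap.ext fun v => ?_)
      have h5 : dRe j q = ((proj q).1 j).re := rfl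
      have h6 : dIm j q = ((proj q).1 j).im := rfl
      simp [dx, h5, h6]
      ring
    · exact (dx (proj q) (Sum.inr l)).hasFDerivAt
  · rintro (j | l)
    · have h0 := ne_zero_of_mem_domain hq j
      have h0' := ne_zero_base_of_mem_domain hq j
      have h1 : HasFDerivAt (fun q : Cover m k => q.1 j / q₀.1 j)
          ((q₀.1 j)⁻¹ • complexCoord m k j) q := by
        simp only [div_eq_inv_mul]
        exact ((complexCoord m k j).hasFDerivAt (x := q)).const_mul (q₀.1 j)⁻¹
      have h2 := (Complex.hasStrictDerivAt_log (hq j)).hasDerivAt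
      have h3 := Complex.imCLM.hasFDerivAt.comp q (h2.comp_hasFDerivAt q h1)
      refine h3.congr_fderiv (ContinuousLinearMap.ext fun v => ?_)
      have h4 : (q.1 j / q₀.1 j)⁻¹ * ((q₀.1 j)⁻¹ * v.1 j) = v.1 j / q.1 j := by
        field_simp
      refine (congrArg Complex.im h4).trans ?_
      have h5 := two_moment_eq (proj q) j
      simp only [dθ, Sum.elim_inl, _root_.smul_apply, h5, Complex.div_im, Complex.normSq_apply,
        smul_eq_mul]
      change _ = _ * ((q.1 j).re * (v.1 j).im - (q.1 j).im * (v.1 j).re)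
      simp only [proj]
      rw [← sub_div, div_eq_inv_mul]
      ring_nf
    · exact (dTorus l).hasFDerivAt

theorem fderiv_actionAngle {q₀ q : Cover m k} (hq : q ∈ actionAngleDomain q₀) (v : Cover m k) :
    fderiv ℝ (actionAngle q₀) q v = (fun i => dx (proj q) i v, fun i => dθ (proj q) i v) := by
  rw [(hasFDerivAt_actionAngle hq).fderiv]
  rfl

theorem actionAngle_mem_interior {q₀ q : Cover m k} (hq : q ∈ actionAngleDomain q₀) :
    (actionAngle q₀ q).1 ∈ interiorPolyhedron m k := by
  intro j
  have := two_moment_pos (proj q) (j := j) (ne_zero_of_mem_domain hq j)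
  change 0 < moment (proj q) (Sum.inl j)
  linarith

theorem hess_actionAngle (hs : 0 < s) (q₀ q : Cover m k) :
    hess potential₂ (s⁻¹ • A) (actionAngle q₀ q).1 = hessG A s (proj q) := by
  rw [hessG, smul_diagonal_add_eq_hess hs]
  rfl

theorem coverMetric_eq_pullback (hA : A.PosDef) (hs : 0 < s) {q₀ q : Cover m k}
    (hq : q ∈ actionAngleDomain q₀) (u v : Cover m k) :
    coverMetric A s q u v = actionAngleMetric potential₂ (s⁻¹ • A) (actionAngle q₀ q)
      (fderiv ℝ (actionAngle q₀) q u) (fderiv ℝ (actionAngle q₀) q v) := by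
  rw [coverMetric, metric_eq_openMetric hA hs _ (ne_zero_of_mem_domain hq),
    actionAngleMetric_apply, hess_actionAngle hs, fderiv_actionAngle hq, fderiv_actionAngle hq,
    openMetric, _root_.add_apply, _root_.add_apply, tensorForm_apply, tensorForm_apply]

theorem isLocalIsometryOn_actionAngle (hA : A.PosDef) (hs : 0 < s) (q₀ : Cover m k) :
    IsLocalIsometryOn (coverMetric A s) (actionAngleMetric potential₂ (s⁻¹ • A))
      (actionAngle q₀) (actionAngleDomain q₀) where
  isOpen := isOpen_actionAngleDomain q₀
  smooth _ hq := contDiffAt_actionAngle hq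
  immersive q hq := by
    have hinj : Function.Injective (fderiv ℝ (actionAngle q₀) q).toLinearMap := by
      rw [injective_iff_map_eq_zero]
      intro v hv
      by_contra hv0
      have h1 := metric_pos hA hs (proj q) hv0
      have h2 := coverMetric_eq_pullback hA hs hq v v
      have h3 : fderiv ℝ (actionAngle q₀) q v = 0 := hv
      rw [h3, map_zero] at h2
      rw [coverMetric] at h2
      exact h1.ne' h2
    have hdim : Module.finrank ℝ (Cover m k) =
        Module.finrank ℝ ((Fin m ⊕ Fin k → ℝ) × (Fin m ⊕ Fin k → ℝ)) := by
      simp [Module.finrank_pi_fintype, Complex.finrank_real_complex]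
      ring
    refine ⟨(LinearEquiv.ofInjectiveOfFinrankEq _ hinj hdim).toContinuousLinearEquiv, ?_⟩
    exact ContinuousLinearMap.ext fun v => rfl
  smooth_source _ _ := (contDiff_metric hA hs).contDiffAt
  smooth_target _ hq := (isHessianOn_model hA hs).contDiffAt_metric (actionAngle_mem_interior hq)
  nondegenerate_source q _ := coverMetric_isInvertible hA hs q
  nondegenerate_target _ hq :=
    (isHessianOn_model hA hs).metric_isInvertible (actionAngle_mem_interior hq)
  symm _ hq := (isHessianOn_model hA hs).metric_symm (actionAngle_mem_interior hq)
  pullback _ hq := coverMetric_eq_pullback hA hs hq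

/-! ### The uniform lower bound for the Ricci tensor -/

/-- The bound on the open dense set where action-angle coordinates exist, away from the codimension
two faces. -/
theorem exists_le_ricci_of_ne_zero (hA : A.PosDef) {ε : ℝ} (hε : 0 < ε) :
    ∃ κ : ℝ, ∀ s : ℝ, 0 < s → ∀ q : Cover m k, (∀ j, q.1 j ≠ 0) →
      (∀ i j : Fin m, i ≠ j →
        ε * √s < moment (proj q) (Sum.inl i) ∨ ε * √s < moment (proj q) (Sum.inl j)) →
      ∀ v : Cover m k, κ * coverMetric A s q v v ≤ ricci (coverMetric A s) q v v := by
  obtain ⟨κ, hκ⟩ := exists_le_ricciForm hA (c := 1 / (4 * ε ^ 2)) (by positivity)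
  refine ⟨κ, fun s hs q hq hpair v => ?_⟩
  have hmem := self_mem_domain hq
  have H := isHessianOn_model (m := m) (k := k) hA hs
  have hint := actionAngle_mem_interior hmem
  have hx : ∀ j, 0 < moment (proj q) (Sum.inl j) := hint
  obtain ⟨Y, hY⟩ : ∃ Y : Fin m ⊕ Fin k → ℝ,
    Y = Sum.elim (fun j => s / (2 * moment (proj q) (Sum.inl j))) 0 := ⟨_, rfl⟩
  have hY0 : ∀ i, 0 ≤ Y i := by
    rw [hY]
    rintro (j | l)
    · have := hx j
      simp only [Sum.elim_inl]
      positivity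
    · simp
  have hG : hess potential₂ (s⁻¹ • A) (actionAngle q q).1 = s⁻¹ • (Matrix.diagonal Y + A) := by
    rw [hess_actionAngle hs, hessG, hY]
  have ha : (fun i => potential₃ i ((actionAngle q q).1 i)) = fun i => 2 * Y i ^ 2 / s ^ 2 := by
    rw [hY]
    funext i
    rcases i with j | l
    · have := hx j
      simp only [potential₃, Sum.elim_inl, actionAngle]
      field_simp
    · simp [potential₃]
  have hb : (fun i => potential₄ i ((actionAngle q q).1 i)) =
      fun i => -(8 * Y i ^ 3 / s ^ 3) := by
    rw [hY]
    funext i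
    rcases i with j | l
    · have := hx j
      simp only [potential₄, Sum.elim_inl, actionAngle]
      field_simp
      ring
    · simp [potential₄]
  have hsmall : ∀ j, ε * √s < moment (proj q) (Sum.inl j) →
      Y (Sum.inl j) ^ 2 ≤ 1 / (4 * ε ^ 2) * s := by
    intro j hj
    have h1 := Real.sqrt_pos.2 hs
    have h2 : Y (Sum.inl j) ≤ s / (2 * (ε * √s)) := by
      rw [hY, Sum.elim_inl]
      gcongr
    calc Y (Sum.inl j) ^ 2 ≤ (s / (2 * (ε * √s))) ^ 2 := by
          gcongr
          exact hY0 _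
      _ = 1 / (4 * ε ^ 2) * s := by
        rw [div_pow, mul_pow, mul_pow, Real.sq_sqrt hs.le]
        field_simp
        norm_num
  have hinr : ∀ l, Y (Sum.inr l) ^ 2 ≤ 1 / (4 * ε ^ 2) * s := by
    intro l
    rw [hY, Sum.elim_inr, Pi.zero_apply, zero_pow two_ne_zero]
    positivity
  have hpair' : ∀ i j, i ≠ j →
      Y i ^ 2 ≤ 1 / (4 * ε ^ 2) * s ∨ Y j ^ 2 ≤ 1 / (4 * ε ^ 2) * s := by
    rintro (i | i) (j | j) hij
    · exact (hpair i j fun h => hij (h ▸ rfl)).imp (hsmall i) (hsmall j)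
    · exact Or.inr (hinr j)
    · exact Or.inl (hinr i)
    · exact Or.inr (hinr j)
  have hbound := hκ s hs Y hY0 hpair'
  rw [(isLocalIsometryOn_actionAngle hA hs q).ricci_source hmem, H.ricci_metric hint,
    coverMetric_eq_pullback hA hs hmem, actionAngleMetric_apply]
  obtain ⟨w, hw⟩ : ∃ w, w = fderiv ℝ (actionAngle q) q v := ⟨_, rfl⟩
  rw [← hw]
  -- the angular part of the metric is that of the vector `G⁻¹ t` in the action directions
  have hang : dotProduct w.2 ((hess potential₂ (s⁻¹ • A) (actionAngle q q).1)⁻¹.mulVec w.2) =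
      dotProduct ((hess potential₂ (s⁻¹ • A) (actionAngle q q).1)⁻¹.mulVec w.2)
        ((hess potential₂ (s⁻¹ • A) (actionAngle q q).1).mulVec
          ((hess potential₂ (s⁻¹ • A) (actionAngle q q).1)⁻¹.mulVec w.2)) := by
    rw [Matrix.mulVec_mulVec, H.hess_mul_inv hint, Matrix.one_mulVec, dotProduct_comm]
  rw [hang, mul_add, hG, ha, hb]
  exact add_le_add (hbound _) (hbound _)

theorem dense_ne_zero (m k : ℕ) : Dense {q : Cover m k | ∀ j, q.1 j ≠ 0} := by
  have h1 : Dense (Set.pi Set.univ fun _ : Fin m => ({0}ᶜ : Set ℂ)) :=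
    dense_pi _ fun _ _ => dense_compl_singleton 0
  have h2 := h1.prod (dense_univ (X := (Fin k → ℝ) × (Fin k → ℝ)))
  convert h2 using 1
  ext q
  simp

end Chart

end ToricModel

end

theorem mainTheorem7 (m k : ℕ) (A : Matrix (Fin m ⊕ Fin k) (Fin m ⊕ Fin k) ℝ) (hA : A.PosDef)
    (r : ℝ) (hr : 0 < r) :
    ∃ κ : ℝ, ∀ s : ℝ, 0 < s → s < 1 →
      ∀ q : ToricModel.Cover m k,
        ToricModel.proj q ∉ ToricModel.nbhd A s (ToricModel.codimTwo m k) r →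
        ∀ v : ToricModel.Cover m k,
          κ * ToricModel.coverMetric A s q v v ≤
            ToricModel.ricci (ToricModel.coverMetric A s) q v v := by
  obtain ⟨ε, hε, hfar⟩ := ToricModel.exists_sqrt_lt_moment A hr
  obtain ⟨κ, hκ⟩ := ToricModel.exists_le_ricci_of_ne_zero hA hε
  refine ⟨κ, fun s hs hs1 q hq v => ?_⟩
  have hcont : ∀ j : Fin m, Continuous fun q : ToricModel.Cover m k =>
      ToricModel.moment (ToricModel.proj q) (Sum.inl j) := by
    intro j
    simp only [ToricModel.moment, ToricModel.proj, Sum.elim_inl]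
    fun_prop
  let S : Set (ToricModel.Cover m k) := {q | ∀ i j : Fin m, i ≠ j →
    ε * √s < ToricModel.moment (ToricModel.proj q) (Sum.inl i) ∨
    ε * √s < ToricModel.moment (ToricModel.proj q) (Sum.inl j)}
  have hS : IsOpen S := by
    simp only [S, Set.ofPred_forall]
    refine isOpen_iInter_of_finite fun i => isOpen_iInter_of_finite fun j =>
      isOpen_iInter_of_finite fun _ => ?_
    exact (isOpen_lt continuous_const (hcont i)).union (isOpen_lt continuous_const (hcont j))
  -- both sides are continuous, and the points of `S` with all `ζⱼ ≠ 0` are dense in `S`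
  have hclosed : IsClosed {q | κ * ToricModel.coverMetric A s q v v ≤
      ToricModel.ricci (ToricModel.coverMetric A s) q v v} := by
    refine isClosed_le (continuous_const.mul ?_)
      (ToricModel.continuous_ricci (ToricModel.contDiff_metric hA hs)
        (ToricModel.coverMetric_isInvertible hA hs) v v)
    exact ((ToricModel.contDiff_metric hA hs).continuous.clm_apply continuous_const).clm_apply
      continuous_const
  have hqS : q ∈ closure (S ∩ {q | ∀ j, q.1 j ≠ 0}) :=
    (ToricModel.dense_ne_zero m k).open_subset_closure_inter hS (hfar s hs hs1 q hq)
  exact closure_minimal (fun y hy => hκ s hs y hy.2 hy.1 v) hclosed hqS
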